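/- Let $p$ be an odd prime. Congruences modulo $p^2$ between rational numbers are understood in the ring $\mathbb{Z}_{(p)}$ of rational numbers whose reduced denominator is not divisible by $p$ (both sides lie in $\mathbb{Z}_{(p)}$ and differ by $p^2$ times an element of $\mathbb{Z}_{(p)}$). (i) If $p = x^2 + 4y^2$ with integers $x, y$ and $x \equiv 1 \pmod 4$ (so that $p \equiv 1 \pmod 4$), then $$\sum_{k=0}^{p-1} \frac{\binom{2k}{k}^2}{(-16)^k (2k-1)^2} \equiv (-1)^{\frac{p-1}{4}}\,\frac{p}{x} \pmod{p^2}.$$ (ii) If $p \equiv 3 \pmod 4$, then $$\sum_{k=0}^{p-1} \frac{\binom{2k}{k}^2}{(-16)^k (2k-1)^2} \equiv (-1)^{\frac{p+1}{4}} \left(2p + 3 - 2^{p-1}\right) \binom{\frac{p-1}{2}}{\frac{p-3}{4}} \pmod{p^2}$$ and $$\sum_{k=0}^{p-1} \frac{\binom{2k}{k}^2}{(-16)^k (2k-1)} \equiv \frac12 (-1)^{\frac{p-3}{4}} \left(2p + 3 - 2^{p-1}\right) \binom{\frac{p-1}{2}}{\frac{p-3}{4}} - (-1)^{\frac{p-3}{4}}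 \frac{p}{\binom{(p-1)/2}{(p-3)/4}} \pmod{p^2}.$$ -/

import Mathlib

/-- `a ≡ b (mod p ^ n)` for rational numbers, in the ring of rational `p`-adic integers (the
rationals whose reduced denominator is not divisible by the prime `p`): `a` and `b` lie in that
ring, and they differ by `p ^ n` times an element of it. -/
def RatModEq (p n : ℕ) (a b : ℚ) : Prop :=
  ¬ p ∣ a.den ∧ ¬ p ∣ b.den ∧ ∃ r : ℚ, ¬ p ∣ r.den ∧ a - b = (p : ℚ) ^ n * r

/-! ### Rationals integral at p and congruences modulo p². -/

namespace RatCongr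

open Finset

variable (p : ℕ) [Fact p.Prime]

/-! Since C(2k,k)/(2k-1) = -(-4)^k C(1/2,k), the first sum is S = ∑ (-1)^k C(1/2,k)². Put N =
(p+1)/2, so that 1/2 = N - p/2. Expanding C(·,k) to first order at N, the linear terms cancel in
C(1/2,k)² ≡ 2C(N,k)² - C(N,k)C(N+p,k) mod p² (`halfChoose_sq_congrSq`). As (1+X)^N (1-X)^(N+q) =
(1-X²)^N (1-X)^q, this yields S ≡ 2[X^N](1-X²)^N - [X^N](1-X²)^N(1-X)^p, and the last coefficient is
accessible through C(p,j) ≡ (-1)^(j-1) p/j.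

If p = 4r+1, then N is odd and the first coefficient vanishes; the second is p times a partial
fraction sum equal to (-16)^r/((2r+1)C(2r,r)), up to sign. Only its value mod p matters, and Gauss's
congruence C(2r,r) ≡ 2x mod p, proved with a quartic Jacobi sum, finishes.

If p = 4r+3, then N = 2m is even. Vandermonde reduces the second coefficient to C(2m+p,m), whose
first-order expansion has a harmonic sum expressible through 2^(p-1).

For the other sum, 2k-1 = -(1 + (1-4k))/2 leaves S weighted by 1-4k. Symmetry and absorption of the
weight into the binomials reduce it to [X^(N-1)](1-X²)^(N-1)(1-X)^p, again of the odd type. -/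

/-- The rationals whose reduced denominator is prime to `p`. -/
def integralRat : Subring ℚ where
  carrier := {q | ¬ p ∣ q.den}
  mul_mem' {a b} ha hb h :=
    ((Fact.out : p.Prime).dvd_mul.mp (h.trans (Rat.mul_den_dvd a b))).elim ha hb
  one_mem' := by simpa using (Fact.out : p.Prime).ne_one
  add_mem' {a b} ha hb h :=
    ((Fact.out : p.Prime).dvd_mul.mp (h.trans (Rat.add_den_dvd a b))).elim ha hb
  zero_mem' := by simpa using (Fact.out : p.Prime).ne_one
  neg_mem' {a} ha := by simpa using ha

variable {p}

theorem mem_integralRat {q : ℚ} : q ∈ integralRat p ↔ ¬ p ∣ q.den := Iff.rfl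

theorem inv_natCast_mem {k : ℕ} (hk : ¬ p ∣ k) : ((k : ℚ)⁻¹) ∈ integralRat p := by
  rw [mem_integralRat]
  rcases Nat.eq_zero_or_pos k with rfl | h
  · simp at hk
  · simpa [Rat.inv_natCast_den_of_pos h] using hk

theorem inv_intCast_mem {k : ℤ} (hk : ¬ (p : ℤ) ∣ k) : ((k : ℚ)⁻¹) ∈ integralRat p := by
  have h : ¬ p ∣ k.natAbs := by rwa [Int.natCast_dvd] at hk
  have h' := inv_natCast_mem h
  rcases Int.natAbs_eq k with hk' | hk' <;> rw [hk'] <;> push_cast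
  · simpa using h'
  · rw [inv_neg]; exact neg_mem (by simpa using h')

/-- Congruence of rationals modulo `p ^ 2` times the `p`-integral rationals. -/
def CongrSq (p : ℕ) [Fact p.Prime] (a b : ℚ) : Prop :=
  ∃ r ∈ integralRat p, a - b = (p : ℚ) ^ 2 * r

namespace CongrSq

variable {a b c d : ℚ}

theorem refl (a : ℚ) : CongrSq p a a := ⟨0, zero_mem _, by ring⟩

theorem of_eq (h : a = b) : CongrSq p a b := h ▸ refl a

theorem symm (h : CongrSq p a b) : CongrSq p b a := by
  obtain ⟨r, hr, h⟩ := h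
  exact ⟨-r, neg_mem hr, by linear_combination -h⟩

theorem trans (h : CongrSq p a b) (h' : CongrSq p b c) : CongrSq p a c := by
  obtain ⟨r, hr, h⟩ := h
  obtain ⟨s, hs, h'⟩ := h'
  exact ⟨r + s, add_mem hr hs, by linear_combination h + h'⟩

theorem add (h : CongrSq p a b) (h' : CongrSq p c d) : CongrSq p (a + c) (b + d) := by
  obtain ⟨r, hr, h⟩ := h
  obtain ⟨s, hs, h'⟩ := h'
  exact ⟨r + s, add_mem hr hs, by linear_combination h + h'⟩

theorem mul_left (hc : c ∈ integralRat p) (h : CongrSq p a b) : CongrSq p (c * a) (c * b) := by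
  obtain ⟨r, hr, h⟩ := h
  exact ⟨c * r, mul_mem hc hr, by linear_combination c * h⟩

theorem sub (h : CongrSq p a b) (h' : CongrSq p c d) : CongrSq p (a - c) (b - d) := by
  obtain ⟨r, hr, h⟩ := h
  obtain ⟨s, hs, h'⟩ := h'
  exact ⟨r - s, sub_mem hr hs, by linear_combination h - h'⟩

theorem sum {ι : Type*} {s : Finset ι} {f g : ι → ℚ} (h : ∀ i ∈ s, CongrSq p (f i) (g i)) :
    CongrSq p (∑ i ∈ s, f i) (∑ i ∈ s, g i) := by
  classical
  induction s using Finset.induction_on with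
  | empty => exact refl _
  | insert a s ha ih =>
    rw [sum_insert ha, sum_insert ha]
    exact (h a (mem_insert_self a s)).add (ih fun i hi => h i (mem_insert_of_mem hi))

theorem mem_right (ha : a ∈ integralRat p) (h : CongrSq p a b) : b ∈ integralRat p := by
  obtain ⟨r, hr, h⟩ := h
  rw [show b = a - (p : ℚ) ^ 2 * r by linear_combination -h]
  exact sub_mem ha (mul_mem (pow_mem (natCast_mem _ p) 2) hr)

theorem ratModEq (hb : b ∈ integralRat p) (h : CongrSq p a b) : RatModEq p 2 a b :=
  ⟨h.symm.mem_right hb, hb, h⟩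

end CongrSq

theorem prod_one_add_mul_congrSq {ι : Type*} (s : Finset ι) {u : ι → ℚ}
    (hu : ∀ i ∈ s, u i ∈ integralRat p) :
    CongrSq p (∏ i ∈ s, (1 + p * u i)) (1 + p * ∑ i ∈ s, u i) := by
  classical
  induction s using Finset.induction_on with
  | empty => exact CongrSq.of_eq (by simp)
  | insert a s ha ih =>
    rw [prod_insert ha, sum_insert ha]
    have hua := hu a (mem_insert_self a s)
    have hus : ∀ i ∈ s, u i ∈ integralRat p := fun i hi => hu i (mem_insert_of_mem hi)
    have hp : (p : ℚ) ∈ integralRat p := natCast_mem _ p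
    refine ((ih hus).mul_left (add_mem (one_mem _) (mul_mem hp hua))).trans
      ⟨u a * ∑ i ∈ s, u i, mul_mem hua (sum_mem hus), by ring⟩

theorem not_dvd_of_pos_of_lt {p k : ℕ} (h0 : 0 < k) (hk : k < p) : ¬ p ∣ k :=
  fun h => absurd (Nat.le_of_dvd h0 h) (by omega)

theorem inv_factorial_mem {k : ℕ} (hk : k < p) : ((k.factorial : ℚ)⁻¹) ∈ integralRat p :=
  inv_natCast_mem fun h => absurd (((Fact.out : p.Prime).dvd_factorial).mp h) (by omega)

/-- `C(p, j) ≡ (-1)^(j-1) p / j` modulo `p ^ 2` for `0 < j < p`. -/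
theorem choose_prime_congrSq {j : ℕ} (h0 : 0 < j) (hj : j < p) :
    CongrSq p (p.choose j) (-(-1) ^ j * p / j) := by
  obtain ⟨i, rfl⟩ : ∃ i, j = i + 1 := ⟨j - 1, by omega⟩
  obtain ⟨q, hq⟩ : ∃ q, p = q + 1 := ⟨p - 1, by omega⟩
  -- C(p-1,i) ≡ (-1)^i mod p by Pascal's rule; then j C(p,j) = p C(p-1,j-1) gains the second factor
  -- p.
  have key : ∀ i < p, ∃ z : ℤ, ((p - 1).choose i : ℤ) = (-1) ^ i + p * z := by
    intro i
    induction i with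
    | zero => exact fun _ => ⟨0, by simp⟩
    | succ i ih =>
      intro hi
      obtain ⟨z, hz⟩ := ih (by omega)
      obtain ⟨w, hw⟩ := (Fact.out : p.Prime).dvd_choose_self (k := i + 1) (by omega) hi
      have h1 : p.choose (i + 1) = (p - 1).choose i + (p - 1).choose (i + 1) := by
        conv_lhs => rw [hq]
        rw [Nat.choose_succ_succ, hq, Nat.add_sub_cancel]
      refine ⟨w - z, ?_⟩
      have h2 : ((p - 1).choose i : ℤ) + (p - 1).choose (i + 1) = p * w := by
        exact_mod_cast h1.symm.trans hw
      rw [pow_succ]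
      linear_combination h2 - hz
  obtain ⟨z, hz⟩ := key i (by omega)
  have hz' : ((p - 1).choose i : ℚ) = (-1) ^ i + p * z := by exact_mod_cast hz
  have h3 : (p : ℚ) * (p - 1).choose i = p.choose (i + 1) * ((i + 1 : ℕ) : ℚ) := by
    have := Nat.add_one_mul_choose_eq (p - 1) i
    rw [show p - 1 + 1 = p by omega] at this
    exact_mod_cast this
  have hne : ((i + 1 : ℕ) : ℚ) ≠ 0 := by positivity
  refine ⟨z * ((i + 1 : ℕ) : ℚ)⁻¹,
    mul_mem (intCast_mem _ z) (inv_natCast_mem (not_dvd_of_pos_of_lt h0 hj)), ?_⟩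
  rw [hz'] at h3
  field_simp
  rw [pow_succ]
  linear_combination -h3

/-- Multiplying the two representations gives p² = v² + 4u² with u = ay ∓ bx, and p divides the
product of the two possible u. A nonzero multiple of p is too large for u, so one of them is zero.
-/
theorem sq_add_four_mul_sq_unique {p : ℕ} (hp : p.Prime) {a b x y : ℤ}
    (h1 : (p : ℤ) = a ^ 2 + 4 * b ^ 2) (h2 : (p : ℤ) = x ^ 2 + 4 * y ^ 2) : a ^ 2 = x ^ 2 := by
  have hp0 : (0 : ℤ) < p := by exact_mod_cast hp.pos
  have key : ∀ u : ℤ, ∀ v : ℤ, (p : ℤ) ^ 2 = v ^ 2 + 4 * u ^ 2 → (p : ℤ) ∣ u → u = 0 := by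
    rintro u v h ⟨w, rfl⟩
    by_contra hne
    have hw : w ≠ 0 := by rintro rfl; simp at hne
    have hw1 : 1 ≤ w ^ 2 := by have := sq_pos_of_ne_zero hw; omega
    nlinarith [sq_nonneg v, mul_le_mul_of_nonneg_left hw1 (sq_nonneg (p : ℤ)), pow_pos hp0 2]
  have hsq : (a * y) ^ 2 = (x * b) ^ 2 := by
    have hd : (p : ℤ) ∣ (a * y - x * b) * (a * y + x * b) :=
      ⟨y ^ 2 - b ^ 2, by linear_combination (-y ^ 2) * h1 + b ^ 2 * h2⟩
    rcases (Nat.prime_iff_prime_int.mp hp).dvd_or_dvd hd with h | h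
    · have := key _ (a * x + 4 * b * y) (by linear_combination (p : ℤ) * h1 +
        (a ^ 2 + 4 * b ^ 2) * h2) h
      rw [sub_eq_zero.mp this]
    · have := key _ (a * x - 4 * b * y) (by linear_combination (p : ℤ) * h1 +
        (a ^ 2 + 4 * b ^ 2) * h2) h
      rw [eq_neg_of_add_eq_zero_left this, neg_sq]
  have hyb : (p : ℤ) * (y ^ 2 - b ^ 2) = 0 := by
    linear_combination y ^ 2 * h1 - b ^ 2 * h2 + hsq
  have : y ^ 2 - b ^ 2 = 0 := (mul_eq_zero.mp hyb).resolve_left hp0.ne'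
  linear_combination h2 - h1 + 4 * this

/-! ### Power sums and beta-type sums over the prime field. -/

section FieldSums

variable {p : ℕ} [Fact p.Prime]

theorem sum_pow_zmod_eq_zero {i : ℕ} (h : i < 2 * (p - 1)) (h' : i ≠ p - 1) :
    ∑ t : ZMod p, t ^ i = 0 := by
  rcases lt_or_gt_of_ne h' with hi | hi
  · exact FiniteField.sum_pow_lt_card_sub_one (K := ZMod p) i (by rwa [ZMod.card])
  · have h0 : i - (p - 1) ≠ 0 := by omega
    have : ∀ t : ZMod p, t ^ i = t ^ (i - (p - 1)) := by
      intro t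
      rcases eq_or_ne t 0 with rfl | ht
      · rw [zero_pow (by omega), zero_pow h0]
      · conv_lhs => rw [show i = (p - 1) + (i - (p - 1)) by omega, pow_add,
          ZMod.pow_card_sub_one_eq_one ht, one_mul]
    simp_rw [this]
    exact FiniteField.sum_pow_lt_card_sub_one (K := ZMod p) _ (by rw [ZMod.card]; omega)

theorem sum_pow_card_sub_one : ∑ t : ZMod p, t ^ (p - 1) = -1 := by
  have hp1 : p - 1 ≠ 0 := by have := (Fact.out : p.Prime).two_le; omega
  have : ∀ t : ZMod p, t ^ (p - 1) = 1 - if t = 0 then 1 else 0 := by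
    intro t
    rcases eq_or_ne t 0 with rfl | ht
    · simp [hp1]
    · simp [ZMod.pow_card_sub_one_eq_one ht, ht]
  simp_rw [this]
  simp

theorem sum_pow_mul_one_sub_pow (a b : ℕ) :
    ∑ t : ZMod p, t ^ a * (1 - t) ^ b =
      ∑ i ∈ range (b + 1), (-1) ^ i * (b.choose i : ZMod p) * ∑ t : ZMod p, t ^ (a + i) := by
  simp_rw [mul_sum]
  rw [sum_comm]
  refine sum_congr rfl fun t _ => ?_
  rw [show (1 - t) = -t + 1 by ring, add_pow, mul_sum]
  refine sum_congr rfl fun i _ => ?_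
  rw [one_pow, mul_one, neg_pow, pow_add]
  ring

theorem sum_pow_mul_one_sub_pow_eq_zero {a b : ℕ} (h : a + b < p - 1) :
    ∑ t : ZMod p, t ^ a * (1 - t) ^ b = 0 := by
  rw [sum_pow_mul_one_sub_pow]
  refine sum_eq_zero fun i hi => ?_
  rw [mem_range] at hi
  rw [sum_pow_zmod_eq_zero (by omega) (by omega), mul_zero]

theorem sum_pow_mul_one_sub_pow_eq_choose {a b i : ℕ} (hi : a + i = p - 1) (hib : i ≤ b)
    (h : a + b < 2 * (p - 1)) :
    ∑ t : ZMod p, t ^ a * (1 - t) ^ b = -((-1) ^ i * (b.choose i : ZMod p)) := by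
  rw [sum_pow_mul_one_sub_pow, sum_eq_single i]
  · rw [hi, sum_pow_card_sub_one, mul_neg_one]
  · intro j hj hne
    rw [mem_range] at hj
    rw [sum_pow_zmod_eq_zero (by omega) (by omega), mul_zero]
  · intro h'
    exact absurd (mem_range.mpr (by omega)) h'

end FieldSums

/-! ### Quartic Jacobi sums and Gauss's congruence. -/

section Quartic

variable {p : ℕ} [Fact p.Prime]

local notation "ℤ[i]" => GaussianInt

/-- A quartic character of `ZMod p` with Gaussian integer values that reduces to the `r`-th power
map under a homomorphism to `ZMod p`, where `p = 4 r + 1`. -/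
theorem exists_quartic_char {r : ℕ} (hr : p = 4 * r + 1) :
    ∃ (f : ℤ[i] →+* ZMod p) (χ : MulChar (ZMod p) ℤ[i]),
      (∀ t, f (χ t) = t ^ r) ∧ χ ^ 4 = 1 ∧ (∃ g, χ g = ⟨0, 1⟩) := by
  classical
  have hp := (Fact.out : p.Prime)
  have hr0 : 0 < r := by have := hp.two_le; omega
  obtain ⟨g, hg⟩ := IsCyclic.exists_generator (α := (ZMod p)ˣ)
  have hcard : Fintype.card (ZMod p)ˣ = 4 * r := by rw [ZMod.card_units]; omega
  have hord : orderOf g = 4 * r := by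
    rw [orderOf_eq_card_of_forall_mem_zpowers hg, Nat.card_eq_fintype_card, hcard]
  have hc : ((g : ZMod p) ^ r) * (g : ZMod p) ^ r = ((-1 : ℤ) : ZMod p) := by
    have h1 : ((g : ZMod p) ^ (2 * r)) ^ 2 = 1 := by
      rw [← pow_mul, ← Units.val_pow_eq_pow_val, show 2 * r * 2 = orderOf g by omega,
        pow_orderOf_eq_one, Units.val_one]
    have h2 : (g : ZMod p) ^ (2 * r) ≠ 1 := by
      intro h
      have h' : g ^ (2 * r) = 1 := by ext; simpa using h
      have := Nat.le_of_dvd (by omega) (orderOf_dvd_of_pow_eq_one h')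
      omega
    rw [← pow_add, ← two_mul]
    simpa using (sq_eq_one_iff.mp h1).resolve_left h2
  -- g^r squares to -1, so i ↦ g^r is a ring map, and it matches χ(g) = i with g^r.
  let f : ℤ[i] →+* ZMod p := Zsqrtd.lift ⟨(g : ZMod p) ^ r, hc⟩
  have hi4 : (⟨0, 1⟩ : ℤ[i]) ^ 4 = 1 := by decide
  let ζ : ℤ[i]ˣ := Units.ofPowEqOne ⟨0, 1⟩ 4 hi4 (by norm_num)
  have hζv : (ζ : ℤ[i]) = ⟨0, 1⟩ := rfl
  have hζ4 : ζ ^ 4 = 1 := by ext1; simpa [hζv] using hi4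
  have hζ : ζ ∈ rootsOfUnity (Fintype.card (ZMod p)ˣ) ℤ[i] := by
    rw [mem_rootsOfUnity, hcard, pow_mul, hζ4, one_pow]
  let χ := MulChar.ofRootOfUnity hζ hg
  have hχg : χ g = ⟨0, 1⟩ := MulChar.ofRootOfUnity_spec hζ hg
  have hfg : f ⟨0, 1⟩ = (g : ZMod p) ^ r := by
    change ((0 : ℤ) : ZMod p) + ((1 : ℤ) : ZMod p) * (g : ZMod p) ^ r = _
    simp
  have hpow : ∀ u : (ZMod p)ˣ, ∃ k : ℕ, u = g ^ k := by
    intro u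
    obtain ⟨k, hk⟩ := (mem_powers_iff_mem_zpowers.mpr (hg u))
    exact ⟨k, hk.symm⟩
  refine ⟨f, χ, ?_, ?_, ⟨g, hχg⟩⟩
  · intro t
    rcases eq_or_ne t 0 with rfl | ht
    · rw [MulChar.map_zero, map_zero, zero_pow hr0.ne']
    · obtain ⟨k, hk⟩ := hpow (Units.mk0 t ht)
      have : t = (g : ZMod p) ^ k := by
        rw [← Units.val_mk0 ht, hk, Units.val_pow_eq_pow_val]
      rw [this, map_pow, hχg, map_pow, hfg, ← pow_mul, ← pow_mul, mul_comm]
  · refine MulChar.ext fun u => ?_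
    obtain ⟨k, rfl⟩ := hpow u
    rw [MulChar.one_apply_coe, MulChar.pow_apply_coe, Units.val_pow_eq_pow_val, map_pow, hχg,
      ← pow_mul, mul_comm, pow_mul, hi4, one_pow]

theorem gaussianInt_of_pow_four_eq_one {z : ℤ[i]} (h : z ^ 4 = 1) :
    z = 1 ∨ z = -1 ∨ z = ⟨0, 1⟩ ∨ z = ⟨0, -1⟩ := by
  have hi : (⟨0, 1⟩ : ℤ[i]) ^ 2 = -1 := by decide
  have h2 : (⟨0, -1⟩ : ℤ[i]) = -⟨0, 1⟩ := by decide
  have : (z - 1) * ((z + 1) * ((z - ⟨0, 1⟩) * (z - ⟨0, -1⟩))) = 0 := by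
    rw [h2]
    linear_combination h - (z ^ 2 - 1) * hi
  simpa [sub_eq_zero, add_eq_zero_iff_eq_neg] using this

theorem mulChar_quartic_apply {χ : MulChar (ZMod p) ℤ[i]} (hχ : χ ^ 4 = 1) {t : ZMod p}
    (ht : t ≠ 0) : χ t = 1 ∨ χ t = -1 ∨ χ t = ⟨0, 1⟩ ∨ χ t = ⟨0, -1⟩ := by
  apply gaussianInt_of_pow_four_eq_one
  rw [← MulChar.pow_apply' χ (by norm_num), hχ, MulChar.one_apply ht.isUnit]

theorem mulChar_quartic_star {χ : MulChar (ZMod p) ℤ[i]} (hχ : χ ^ 4 = 1) (t : ZMod p) :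
    star (χ t) = (χ t) ^ 3 ∧ star ((χ t) ^ 2) = (χ t) ^ 2 := by
  rcases eq_or_ne t 0 with rfl | ht
  · rw [MulChar.map_zero]
    decide
  · rcases mulChar_quartic_apply hχ ht with h | h | h | h <;> rw [h] <;> decide

theorem mulChar_quartic_inv {χ : MulChar (ZMod p) ℤ[i]} (hχ : χ ^ 4 = 1) (t : ZMod p) :
    χ⁻¹ t = star (χ t) := by
  have : χ⁻¹ = χ ^ 3 := inv_eq_of_mul_eq_one_right (by rw [← pow_succ', hχ])
  rw [this, MulChar.pow_apply' _ (by norm_num), (mulChar_quartic_star hχ t).1]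

/-- Conjugation inverts χ and fixes χ², so this is J(χ,χ²)J(χ⁻¹,χ⁻²) = p, read off after embedding
ℤ[i] in the field ℂ. -/
theorem jacobiSum_quartic_norm {χ : MulChar (ZMod p) ℤ[i]} (hχ : χ ^ 4 = 1) {g : ZMod p}
    (hg : χ g = ⟨0, 1⟩) :
    jacobiSum χ (χ ^ 2) * star (jacobiSum χ (χ ^ 2)) = (p : ℤ[i]) := by
  have hinj : Function.Injective GaussianInt.toComplex := fun a b h =>
    GaussianInt.toComplex_inj.mp h
  have hstar : star (jacobiSum χ (χ ^ 2)) = jacobiSum χ⁻¹ (χ ^ 2)⁻¹ := by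
    have h2 : (χ ^ 2)⁻¹ = χ ^ 2 := inv_eq_of_mul_eq_one_right (by rw [← pow_add, hχ])
    rw [h2, jacobiSum, jacobiSum, star_sum]
    refine sum_congr rfl fun t _ => ?_
    rw [star_mul', mulChar_quartic_inv hχ, MulChar.pow_apply' _ (by norm_num),
      (mulChar_quartic_star hχ _).2]
  have hne : ∀ k : ℕ, k ≠ 0 → (⟨0, 1⟩ : ℤ[i]) ^ k ≠ 1 →
      (χ ^ k).ringHomComp GaussianInt.toComplex ≠ 1 := by
    intro k hk0 hk h
    have hg0 : g ≠ 0 := by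
      rintro rfl
      rw [MulChar.map_zero] at hg
      exact absurd hg (by decide)
    have := DFunLike.congr_fun h g
    rw [MulChar.ringHomComp_apply, MulChar.one_apply hg0.isUnit, MulChar.pow_apply' _ hk0, hg,
      ← map_one GaussianInt.toComplex] at this
    exact hk (hinj this)
  have h1 := hne 1 (by norm_num) (by decide)
  have h2 := hne 2 (by norm_num) (by decide)
  have h3 := hne 3 (by norm_num) (by decide)
  rw [pow_one] at h1
  have hchar : ringChar ℂ ≠ ringChar (ZMod p) := by
    rw [ringChar.eq_zero, ZMod.ringChar_zmod_n]
    exact (Fact.out : p.Prime).ne_zero.symm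
  have h := jacobiSum_mul_jacobiSum_inv hchar h1 h2
    (by rw [← MulChar.ringHomComp_mul, ← pow_succ']; exact h3)
  apply hinj
  rw [hstar, map_mul, ← jacobiSum_ringHomComp, ← jacobiSum_ringHomComp, ← MulChar.ringHomComp_inv,
    ← MulChar.ringHomComp_inv, h, ZMod.card, map_natCast]

/-- This normalisation modulo 2+2i fixes the sign of the real part of the Jacobi sum. -/
theorem jacobiSum_quartic_primary {χ : MulChar (ZMod p) ℤ[i]} (hχ : χ ^ 4 = 1) {g : ZMod p}
    (hg : χ g = ⟨0, 1⟩) :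
    (⟨2, 2⟩ : ℤ[i]) ∣ jacobiSum χ (χ ^ 2) + p := by
  have hg0 : g ≠ 0 := by
    rintro rfl
    rw [MulChar.map_zero] at hg
    exact absurd hg (by decide)
  have hne1 : χ ≠ 1 := by
    rintro rfl
    rw [MulChar.one_apply hg0.isUnit] at hg
    exact absurd hg (by decide)
  have hne2 : χ ^ 2 ≠ 1 := by
    intro h
    have := DFunLike.congr_fun h g
    rw [MulChar.one_apply hg0.isUnit, MulChar.pow_apply' _ (by norm_num), hg] at this
    exact absurd this (by decide)
  have hs1 : ∑ t, χ t = 0 := MulChar.sum_eq_zero_of_ne_one hne1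
  have hs2 : ∑ t, (χ ^ 2) (1 - t) = 0 := by
    rw [← MulChar.sum_eq_zero_of_ne_one hne2]
    exact (Equiv.subLeft (1 : ZMod p)).sum_comp fun t => (χ ^ 2) t
  -- Both characters sum to zero, so subtracting 1 from each factor only adds p. For t ≠ 0, 1 the
  -- factors are then divisible by 1+i and by 2.
  have key : jacobiSum χ (χ ^ 2) + p = ∑ t, (χ t - 1) * ((χ ^ 2) (1 - t) - 1) := by
    have : ∀ t, (χ t - 1) * ((χ ^ 2) (1 - t) - 1) =
      χ t * (χ ^ 2) (1 - t) - χ t - (χ ^ 2) (1 - t) + 1 := fun t => by ring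
    simp_rw [this]
    rw [sum_add_distrib, sum_sub_distrib, sum_sub_distrib, hs1, hs2]
    simp [jacobiSum]
  rw [key]
  refine dvd_sum fun t _ => ?_
  rcases eq_or_ne t 0 with rfl | ht
  · simp
  rcases eq_or_ne t 1 with rfl | ht1
  · simp
  rw [MulChar.pow_apply' _ (by norm_num)]
  rcases mulChar_quartic_apply hχ ht with h | h | h | h <;>
  rcases mulChar_quartic_apply hχ (sub_ne_zero.mpr ht1.symm) with h' | h' | h' | h' <;>
  rw [h, h'] <;>
  first
  | exact ⟨0, by decide⟩
  | exact ⟨1, by decide⟩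
  | exact ⟨⟨0, -1⟩, by decide⟩
  | exact ⟨⟨1, -1⟩, by decide⟩

/-- Gauss: if `p = 4 r + 1 = x ^ 2 + 4 y ^ 2` with `x ≡ 1 [ZMOD 4]`, then
`C(2r, r) ≡ 2 x` modulo `p`. -/
theorem choose_two_mul_congr_of_eq_sq_add_four_mul_sq {r : ℕ} (hr : p = 4 * r + 1) {x y : ℤ}
    (hxy : (p : ℤ) = x ^ 2 + 4 * y ^ 2) (hx : x ≡ 1 [ZMOD 4]) :
    (p : ℤ) ∣ ((2 * r).choose r : ℤ) - 2 * x := by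
  have hp := (Fact.out : p.Prime)
  have hr0 : 0 < r := by have := hp.two_le; omega
  obtain ⟨f, χ, hf, hχ, g, hg⟩ := exists_quartic_char hr
  have hnorm := jacobiSum_quartic_norm hχ hg
  obtain ⟨z, hz⟩ := jacobiSum_quartic_primary hχ hg
  set J := jacobiSum χ (χ ^ 2) with hJ
  -- The reduction of J is a sum of a polynomial of degree 3r < p-1, hence zero; for the conjugate
  -- the exponents are 3r and 2r, and the single monomial t^(p-1) contributes.
  have hfJ : f J = 0 := by
    rw [hJ, jacobiSum, map_sum, ← sum_pow_mul_one_sub_pow_eq_zero (p := p) (a := r) (b := 2 * r)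
      (by omega)]
    refine sum_congr rfl fun t _ => ?_
    rw [map_mul, hf, MulChar.pow_apply' _ (by norm_num), map_pow, hf, ← pow_mul, mul_comm r]
  have hfJ' : f (star J) = -((-1) ^ r * ((2 * r).choose r : ZMod p)) := by
    rw [hJ, jacobiSum, star_sum, map_sum, ← sum_pow_mul_one_sub_pow_eq_choose (p := p)
      (a := 3 * r) (b := 2 * r) (i := r) (by omega) (by omega) (by omega)]
    refine sum_congr rfl fun t _ => ?_
    rw [star_mul', MulChar.pow_apply' _ (by norm_num), (mulChar_quartic_star hχ _).1,
      (mulChar_quartic_star hχ _).2, map_mul, map_pow, map_pow, hf, hf, ← pow_mul, ← pow_mul,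
      mul_comm r, mul_comm r]
  have hre : J + star J = ((2 * J.re : ℤ) : ℤ[i]) := by
    ext <;> simp <;> ring
  have hmod : ((2 * J.re : ℤ) : ZMod p) = -((-1) ^ r * ((2 * r).choose r : ZMod p)) := by
    rw [← map_intCast f, ← hre, map_add, hfJ, hfJ', zero_add]
  have hN : (p : ℤ) = J.re ^ 2 + J.im ^ 2 := by
    have := congrArg Zsqrtd.re hnorm
    simp at this
    linear_combination -this
  have hre' : J.re + p = 2 * z.re - 2 * z.im := by
    have := congrArg Zsqrtd.re hz
    simp at this
    linear_combination this
  have him : J.im = 2 * (z.re + z.im) := by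
    have := congrArg Zsqrtd.im hz
    simp at this
    linear_combination this
  set w := z.re + z.im with hw
  have hp4 : (p : ℤ) = J.re ^ 2 + 4 * w ^ 2 := by rw [hN, him]; ring
  have hpr : (p : ℤ) = 4 * r + 1 := by exact_mod_cast hr
  have hsq := sq_add_four_mul_sq_unique hp hp4 hxy
  have hJmod : J.re = 4 * z.re - 2 * w - 4 * r - 1 := by rw [hw]; linear_combination hre' - hpr
  -- With Re J odd, Re J² + 4w² = 4r+1 forces w ≡ r mod 2. Hence Re J ≡ -2r-1 mod 4, which selects
  -- the sign in x = ±Re J.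
  have hpar : w % 2 = (r : ℤ) % 2 := by
    obtain ⟨e, he⟩ : ∃ e : ℤ, J.re = 2 * e + 1 := ⟨2 * z.re - w - 2 * r - 1, by
      linear_combination hJmod⟩
    have h1 : (r : ℤ) = e * (e + 1) + w * w := by
      rw [he] at hp4
      linarith [hp4, hpr]
    have h2 : e * (e + 1) % 2 = 0 := Int.even_iff.mp (Int.even_mul_succ_self e)
    have h3 : w * w % 2 = w % 2 := by
      rcases Int.emod_two_eq_zero_or_one w with h | h <;> simp [Int.mul_emod, h]
    omega
  have hx4 : x % 4 = 1 := hx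
  have hxJ : x = -(-1) ^ r * J.re := by
    rcases Nat.even_or_odd r with he | ho
    · rw [he.neg_one_pow]
      obtain ⟨k, hk⟩ := he
      rcases sq_eq_sq_iff_eq_or_eq_neg.mp hsq with h | h <;> omega
    · rw [ho.neg_one_pow]
      obtain ⟨k, hk⟩ := ho
      rcases sq_eq_sq_iff_eq_or_eq_neg.mp hsq with h | h <;> omega
  rw [← ZMod.intCast_zmod_eq_zero_iff_dvd, hxJ]
  push_cast at hmod ⊢
  have h1 : ((-1 : ZMod p) ^ r) ^ 2 = 1 := by rw [← pow_mul, mul_comm, pow_mul]; simp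
  linear_combination ((-1 : ZMod p) ^ r) * hmod - ((2 * r).choose r : ZMod p) * h1

end Quartic

open Finset Polynomial

/-! ### Exact binomial, coefficient and partial fraction identities. -/

section Identities

/-- The binomial coefficient `C(1/2, k)`. -/
noncomputable def halfChoose (k : ℕ) : ℚ := (descPochhammer ℚ k).eval (1 / 2) / k.factorial

theorem choose_two_mul_eq_halfChoose (k : ℕ) :
    ((2 * k).choose k : ℚ) = -(-4) ^ k * (2 * k - 1) * halfChoose k := by
  rw [← Nat.centralBinom_eq_two_mul_choose]
  induction k with
  | zero => simp [halfChoose]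
  | succ k ih =>
    have h1 : ((k : ℚ) + 1) * (k + 1).centralBinom = 2 * (2 * k + 1) * k.centralBinom := by
      exact_mod_cast Nat.succ_mul_centralBinom_succ k
    have h2 : halfChoose (k + 1) * (k + 1) = halfChoose k * (1 / 2 - k) := by
      have hk : ((k : ℚ) + 1) ≠ 0 := by positivity
      have hf : ((k.factorial : ℕ) : ℚ) ≠ 0 := by positivity
      rw [halfChoose, halfChoose, descPochhammer_succ_eval, Nat.factorial_succ]
      push_cast
      field_simp
    have hk : ((k : ℚ) + 1) ≠ 0 := by positivity
    apply mul_left_cancel₀ hk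
    rw [h1, ih]
    push_cast
    rw [pow_succ]
    linear_combination (-(-4 : ℚ) ^ k * 4 * (2 * k + 1)) * h2

theorem choose_sq_div_eq_halfChoose_sq (k : ℕ) :
    ((2 * k).choose k : ℚ) ^ 2 / ((-16 : ℚ) ^ k * (2 * (k : ℚ) - 1) ^ 2) =
      (-1) ^ k * halfChoose k ^ 2 := by
  have h : (2 * (k : ℚ) - 1) ≠ 0 := by
    intro h
    have : (2 * (k : ℤ) - 1) = 0 := by exact_mod_cast h
    omega
  have h16 : ((-16 : ℚ) ^ k) ≠ 0 := pow_ne_zero _ (by norm_num)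
  rw [choose_two_mul_eq_halfChoose, div_eq_iff (mul_ne_zero h16 (pow_ne_zero _ h))]
  have h4 : ((-4 : ℚ) ^ k) ^ 2 = (-1) ^ k * (-16) ^ k := by
    rw [← pow_mul, mul_comm, pow_mul, ← mul_pow]
    norm_num
  linear_combination ((2 * (k : ℚ) - 1) ^ 2 * halfChoose k ^ 2) * h4

theorem choose_sq_div_eq_halfChoose_sq_mul (k : ℕ) :
    ((2 * k).choose k : ℚ) ^ 2 / ((-16 : ℚ) ^ k * (2 * (k : ℚ) - 1)) =
      (-1) ^ k * halfChoose k ^ 2 * (2 * k - 1) := by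
  have h : (2 * (k : ℚ) - 1) ≠ 0 := by
    intro h
    have : (2 * (k : ℤ) - 1) = 0 := by exact_mod_cast h
    omega
  have h16 : ((-16 : ℚ) ^ k) ≠ 0 := pow_ne_zero _ (by norm_num)
  rw [← choose_sq_div_eq_halfChoose_sq]
  field_simp

theorem coeff_one_sub_X_pow (n k : ℕ) :
    ((1 - X : ℚ[X]) ^ n).coeff k = (-1) ^ k * (n.choose k : ℚ) := by
  have h : (1 - X : ℚ[X]) ^ n = ((1 + X) ^ n : ℚ[X]).comp (C (-1) * X) := by
    simp [sub_eq_add_neg]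
  rw [h, comp_C_mul_X_coeff, coeff_one_add_X_pow, mul_comm]

theorem sum_choose_mul_choose (a b d : ℕ) :
    ∑ k ∈ range (d + 1), (-1) ^ k * (a.choose (d - k) : ℚ) * b.choose k =
      ((1 + X) ^ a * (1 - X) ^ b : ℚ[X]).coeff d := by
  rw [mul_comm, coeff_mul, Nat.sum_antidiagonal_eq_sum_range_succ_mk]
  refine sum_congr rfl fun k _ => ?_
  rw [coeff_one_sub_X_pow, coeff_one_add_X_pow]
  ring

theorem coeff_one_sub_X_sq_pow_mul (M d : ℕ) (f : ℚ[X]) :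
    ((1 - X ^ 2) ^ M * f).coeff d = ∑ i ∈ range (M + 1),
      (-1) ^ i * (M.choose i : ℚ) * if 2 * i ≤ d then f.coeff (d - 2 * i) else 0 := by
  have h : (1 - X ^ 2 : ℚ[X]) ^ M =
      ∑ i ∈ range (M + 1), C ((-1) ^ i * (M.choose i : ℚ)) * X ^ (2 * i) := by
    rw [sub_eq_neg_add, add_pow]
    refine sum_congr rfl fun i _ => ?_
    rw [one_pow, neg_pow, pow_mul]
    simp
    ring
  rw [h, sum_mul, finsetSum_coeff]
  refine sum_congr rfl fun i _ => ?_
  rw [mul_assoc, coeff_C_mul, coeff_X_pow_mul']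

theorem coeff_one_sub_X_sq_pow_of_odd {M d : ℕ} (hd : Odd d) :
    ((1 - X ^ 2 : ℚ[X]) ^ M).coeff d = 0 := by
  rw [← mul_one ((1 - X ^ 2 : ℚ[X]) ^ M), coeff_one_sub_X_sq_pow_mul]
  refine sum_eq_zero fun i _ => ?_
  obtain ⟨l, rfl⟩ := hd
  split_ifs with h
  · rw [coeff_one, if_neg (by omega), mul_zero]
  · rw [mul_zero]

theorem coeff_one_sub_X_sq_pow_two_mul {M l : ℕ} (hl : l ≤ M) :
    ((1 - X ^ 2 : ℚ[X]) ^ M).coeff (2 * l) = (-1) ^ l * (M.choose l : ℚ) := by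
  rw [← mul_one ((1 - X ^ 2 : ℚ[X]) ^ M), coeff_one_sub_X_sq_pow_mul, sum_eq_single l]
  · simp
  · intro i _ hi
    split_ifs with h
    · rw [coeff_one, if_neg (by omega), mul_zero]
    · rw [mul_zero]
  · intro h
    exact absurd (mem_range.mpr (by omega)) h

/-- Partial fractions of n!/(z(z+1)⋯(z+n)); Pascal's rule turns the step in n into a difference
between z and z+1. -/
theorem sum_choose_div_add (n : ℕ) : ∀ z : ℚ, (∀ j : ℕ, z + j ≠ 0) →
    ∑ i ∈ range (n + 1), (-1) ^ i * (n.choose i : ℚ) / (z + i) =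
      n.factorial / ∏ j ∈ range (n + 1), (z + j) := by
  induction n with
  | zero => intro z _; simp
  | succ n ih =>
    intro z hz
    have hz1 : ∀ j : ℕ, z + 1 + j ≠ 0 := fun j => by
      have := hz (j + 1)
      push_cast at this
      rwa [add_assoc, add_comm 1 (j : ℚ)]
    have hrec : ∑ i ∈ range (n + 1 + 1), (-1) ^ i * ((n + 1).choose i : ℚ) / (z + i) =
        ∑ i ∈ range (n + 1), (-1) ^ i * (n.choose i : ℚ) / (z + i) -
        ∑ i ∈ range (n + 1), (-1) ^ i * (n.choose i : ℚ) / (z + 1 + i) := by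
      rw [sum_range_succ']
      have hlast : ∑ i ∈ range (n + 1), (-1) ^ i * (n.choose i : ℚ) / (z + i) =
          ∑ i ∈ range (n + 1), (-1) ^ (i + 1) * (n.choose (i + 1) : ℚ) / (z + (i + 1 : ℕ)) +
            1 / z := by
        have h := sum_range_succ (fun i : ℕ => (-1) ^ i * (n.choose i : ℚ) / (z + i)) (n + 1)
        rw [sum_range_succ' _ (n + 1), Nat.choose_succ_self] at h
        simpa using h.symm
      rw [hlast]
      have : ∀ i : ℕ, (-1) ^ (i + 1) * ((n + 1).choose (i + 1) : ℚ) / (z + (i + 1 : ℕ)) =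
          (-1) ^ (i + 1) * (n.choose (i + 1) : ℚ) / (z + (i + 1 : ℕ)) -
            (-1) ^ i * (n.choose i : ℚ) / (z + 1 + i) := by
        intro i
        rw [Nat.choose_succ_succ, show z + 1 + (i : ℚ) = z + (i + 1 : ℕ) by push_cast; ring,
          ← sub_div]
        push_cast
        ring
      simp_rw [this]
      rw [sum_sub_distrib]
      simp
      ring
    rw [hrec, ih z hz, ih (z + 1) hz1]
    have hA : ∏ j ∈ range (n + 1 + 1), (z + (j : ℚ)) =
        (∏ j ∈ range (n + 1), (z + (j : ℚ))) * (z + (n + 1 : ℕ)) := prod_range_succ _ _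
    have hB : ∏ j ∈ range (n + 1 + 1), (z + (j : ℚ)) =
        (∏ j ∈ range (n + 1), (z + 1 + (j : ℚ))) * z := by
      rw [prod_range_succ']
      congr 1
      · exact prod_congr rfl fun j _ => by push_cast; ring
      · simp
    have hA0 : ∏ j ∈ range (n + 1), (z + (j : ℚ)) ≠ 0 := prod_ne_zero_iff.mpr fun j _ => hz j
    have hB0 : ∏ j ∈ range (n + 1), (z + 1 + (j : ℚ)) ≠ 0 :=
      prod_ne_zero_iff.mpr fun j _ => hz1 j
    have hz0 : z ≠ 0 := by simpa using hz 0
    have hzn := hz (n + 1)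
    have e1 : (n.factorial : ℚ) / ∏ j ∈ range (n + 1), (z + (j : ℚ)) =
        n.factorial * (z + (n + 1 : ℕ)) / ∏ j ∈ range (n + 1 + 1), (z + (j : ℚ)) := by
      rw [hA, mul_div_mul_right _ _ hzn]
    have e2 : (n.factorial : ℚ) / ∏ j ∈ range (n + 1), (z + 1 + (j : ℚ)) =
        n.factorial * z / ∏ j ∈ range (n + 1 + 1), (z + (j : ℚ)) := by
      rw [hB, mul_div_mul_right _ _ hz0]
    rw [e1, e2, ← sub_div, Nat.factorial_succ]
    push_cast
    ring

/-- The factors are ±1/2, …, ±(2r+1)/2; raising r by one adds two end factors with product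
-(r+3/2)². -/
theorem prod_sub_half (r : ℕ) :
    ((2 * r + 1).factorial : ℚ) * ((2 * r + 1) * (2 * r).choose r) =
      -4 * (-16) ^ r * ∏ j ∈ range (2 * r + 2), (-(2 * r + 1) / 2 + (j : ℚ)) := by
  rw [← Nat.centralBinom_eq_two_mul_choose]
  induction r with
  | zero => norm_num [prod_range_succ]
  | succ r ih =>
    have h1 : ((r : ℚ) + 1) * (r + 1).centralBinom = 2 * (2 * r + 1) * r.centralBinom := by
      exact_mod_cast Nat.succ_mul_centralBinom_succ r
    have h2 : ∏ j ∈ range (2 * (r + 1) + 2), (-(2 * ((r + 1 : ℕ) : ℚ) + 1) / 2 + (j : ℚ)) =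
        -((r : ℚ) + 3 / 2) ^ 2 * ∏ j ∈ range (2 * r + 2), (-(2 * (r : ℚ) + 1) / 2 + (j : ℚ)) := by
      rw [show 2 * (r + 1) + 2 = (2 * r + 2 + 1) + 1 by ring, prod_range_succ']
      have : ∀ j : ℕ, (-(2 * ((r + 1 : ℕ) : ℚ) + 1) / 2 + ((j + 1 : ℕ) : ℚ)) =
          -(2 * (r : ℚ) + 1) / 2 + (j : ℚ) := fun j => by push_cast; ring
      simp_rw [this]
      rw [prod_range_succ]
      push_cast
      ring
    rw [h2, show 2 * (r + 1) + 1 = (2 * r + 1) + 1 + 1 by ring, Nat.factorial_succ,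
      Nat.factorial_succ, pow_succ]
    push_cast
    linear_combination (4 * (2 * (r : ℚ) + 3) ^ 2) * ih +
      (2 * (2 * (r : ℚ) + 3) ^ 2 * (2 * r + 1).factorial) * h1

/-- The partial fraction identity at z = -(2r+1)/2. -/
theorem sum_choose_div_sub_two_mul (r : ℕ) :
    ∑ i ∈ range (2 * r + 1 + 1), (-1) ^ i * ((2 * r + 1).choose i : ℚ) / ((2 * r + 1 : ℕ) - 2 * i) =
      2 * (-16) ^ r / ((2 * r + 1) * (2 * r).choose r) := by
  have hz : ∀ j : ℕ, (-(2 * (r : ℚ) + 1) / 2 + j) ≠ 0 := by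
    intro j h
    have : (-(2 * (r : ℤ) + 1) + 2 * j) = 0 := by
      have : (-(2 * (r : ℚ) + 1) + 2 * j) = 0 := by linear_combination 2 * h
      exact_mod_cast this
    omega
  have h := sum_choose_div_add (2 * r + 1) _ hz
  have hc : ((2 * r + 1 : ℚ) * (2 * r).choose r) ≠ 0 := by
    have : 0 < (2 * r).choose r := Nat.choose_pos (by omega)
    positivity
  have hP : ∏ j ∈ range (2 * r + 1 + 1), (-(2 * (r : ℚ) + 1) / 2 + (j : ℚ)) ≠ 0 :=
    prod_ne_zero_iff.mpr fun j _ => hz j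
  have : ∀ i : ℕ, (-1) ^ i * ((2 * r + 1).choose i : ℚ) / ((2 * r + 1 : ℕ) - 2 * i) =
      (-1 / 2) * ((-1) ^ i * ((2 * r + 1).choose i : ℚ) / (-(2 * (r : ℚ) + 1) / 2 + i)) := by
    intro i
    rw [show (((2 * r + 1 : ℕ) : ℚ) - 2 * i) = (-2) * (-(2 * (r : ℚ) + 1) / 2 + i) by
      push_cast; ring]
    have := hz i
    field_simp
  simp_rw [this]
  rw [← mul_sum, h, ← mul_div_assoc, div_eq_div_iff hP hc, mul_assoc, prod_sub_half]
  ring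

theorem sum_inv_sub_eq_alternating (m : ℕ) :
    ∑ i ∈ range m, (1 : ℚ) / ((2 * m : ℕ) - i) = ∑ j ∈ range (2 * m), (-1 : ℚ) ^ j / (j + 1) := by
  have h1 : ∑ i ∈ range m, (1 : ℚ) / ((2 * m : ℕ) - i) =
      ∑ i ∈ range m, (1 : ℚ) / (m + 1 + i) := by
    rw [← sum_range_reflect]
    refine sum_congr rfl fun i hi => ?_
    rw [mem_range] at hi
    rw [Nat.sub_sub, Nat.cast_sub (by omega)]
    push_cast
    congr 1
    ring
  rw [h1]
  clear h1
  induction m with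
  | zero => simp
  | succ m ih =>
    rw [show 2 * (m + 1) = 2 * m + 1 + 1 by ring, sum_range_succ _ (2 * m + 1),
      sum_range_succ _ (2 * m), ← ih]
    have h2 := sum_range_succ (fun i : ℕ => (1 : ℚ) / (m + 1 + i)) m
    rw [sum_range_succ'] at h2
    rw [sum_range_succ]
    have h3 : ∀ i : ℕ, (1 : ℚ) / ((m + 1 : ℕ) + 1 + i) = 1 / (m + 1 + (i + 1 : ℕ)) := fun i => by
      push_cast; congr 1; ring
    simp_rw [h3]
    rw [eq_sub_of_add_eq h2, pow_succ, pow_mul]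
    push_cast
    have a1 : (2 * (m : ℚ) + 1) ≠ 0 := by positivity
    have a2 : ((m : ℚ) + 1) ≠ 0 := by positivity
    have a3 : ((m : ℚ) + 1 + m) ≠ 0 := by positivity
    have a4 : ((m : ℚ) + 1 + (m + 1)) ≠ 0 := by positivity
    have a5 : (2 * (m : ℚ) + 1 + 1) ≠ 0 := by positivity
    rw [show (m : ℚ) + 1 + m = 2 * m + 1 by ring, show (m : ℚ) + 1 + (m + 1) = 2 * (m + 1) by ring,
      show 2 * (m : ℚ) + 1 + 1 = 2 * (m + 1) by ring]
    norm_num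
    field_simp
    ring

theorem choose_add_eq_mul_prod (N q : ℕ) {k : ℕ} (hk : k ≤ N) :
    ((N + q).choose k : ℚ) = N.choose k * ∏ i ∈ range k, (1 + q * ((1 : ℚ) / (N - i))) := by
  induction k with
  | zero => simp
  | succ k ih =>
    have h1 : ((N + q).choose (k + 1) : ℚ) * (k + 1) = (N + q).choose k * (N + q - k) := by
      have := Nat.choose_succ_right_eq (N + q) k
      have h := congrArg (Nat.cast : ℕ → ℚ) this
      rw [Nat.cast_mul, Nat.cast_mul, Nat.cast_sub (by omega)] at h
      exact_mod_cast h
    have h2 : (N.choose (k + 1) : ℚ) * (k + 1) = N.choose k * (N - k) := by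
      have := Nat.choose_succ_right_eq N k
      have h := congrArg (Nat.cast : ℕ → ℚ) this
      rw [Nat.cast_mul, Nat.cast_mul, Nat.cast_sub (by omega)] at h
      exact_mod_cast h
    have hne : ((N : ℚ) - k) ≠ 0 := by
      have : (k : ℚ) < N := by exact_mod_cast hk
      linarith
    have hk1 : ((k : ℚ) + 1) ≠ 0 := by positivity
    rw [ih (by omega)] at h1
    apply mul_right_cancel₀ hk1
    have hinv : (1 + q * ((1 : ℚ) / (N - k))) * (N - k) = N + q - k := by
      field_simp
      ring
    rw [h1, prod_range_succ, ← hinv]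
    linear_combination (-(∏ i ∈ range k, (1 + q * ((1 : ℚ) / (N - i)))) *
      (1 + q * ((1 : ℚ) / (N - k)))) * h2

end Identities

/-! ### Congruences modulo p² for the binomials and coefficients. -/

section Congruences

variable {p : ℕ} [Fact p.Prime]

theorem inv_two_mem (hodd : Odd p) : (1 / 2 : ℚ) ∈ integralRat p := by
  have h : ¬ p ∣ 2 := fun h => by
    have := (Fact.out : p.Prime).two_le
    have := Nat.le_of_dvd (by norm_num) h
    obtain ⟨k, hk⟩ := hodd
    omega
  simpa using inv_natCast_mem h

/-- Taylor expansion over the subring keeps derivative and remainder integral. The coefficient d is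
chosen before h, so that the expansions at h = p and h = -p/2 share it. -/
theorem descPochhammer_eval_add (k : ℕ) {x : ℚ} (hx : x ∈ integralRat p) :
    ∃ d ∈ integralRat p, ∀ h ∈ integralRat p, ∃ e ∈ integralRat p,
      (descPochhammer ℚ k).eval (x + h) = (descPochhammer ℚ k).eval x + d * h + e * h ^ 2 := by
  set P := descPochhammer (integralRat p) k with hP
  have hcoe : ∀ y : integralRat p, ((P.eval y : integralRat p) : ℚ) =
      (descPochhammer ℚ k).eval (y : ℚ) := by
    intro y
    have := descPochhammer_map (integralRat p).subtype k
    rw [← this, eval_map, ← hP]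
    exact (eval₂_at_apply (integralRat p).subtype y).symm
  refine ⟨(P.derivative.eval ⟨x, hx⟩ : integralRat p), SetLike.coe_mem _, fun h hh => ?_⟩
  obtain ⟨e, he⟩ := P.binomExpansion ⟨x, hx⟩ ⟨h, hh⟩
  refine ⟨e, e.2, ?_⟩
  have := congrArg (fun z : integralRat p => (z : ℚ)) he
  simpa [hcoe] using this

theorem halfChoose_sq_congrSq {N : ℕ} (hN : p + 1 = 2 * N) {k : ℕ} (hk : k < p) :
    CongrSq p (halfChoose k ^ 2)
      (2 * (N.choose k : ℚ) ^ 2 - N.choose k * (N + p).choose k) := by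
  have hodd : Odd p := ⟨N - 1, by have := (Fact.out : p.Prime).two_le; omega⟩
  have h2 := inv_two_mem hodd
  have hp : (p : ℚ) ∈ integralRat p := natCast_mem _ p
  have hf := inv_factorial_mem hk
  have hf0 : (k.factorial : ℚ) ≠ 0 := by positivity
  have hc : ∀ n : ℕ, (n.choose k : ℚ) = (descPochhammer ℚ k).eval (n : ℚ) * (k.factorial : ℚ)⁻¹ := by
    intro n
    rw [descPochhammer_eval_eq_descFactorial, Nat.descFactorial_eq_factorial_mul_choose]
    push_cast
    field_simp
  have hNS : (N : ℚ) ∈ integralRat p := natCast_mem _ N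
  have hPN : (descPochhammer ℚ k).eval (N : ℚ) ∈ integralRat p := by
    rw [descPochhammer_eval_eq_descFactorial]
    exact natCast_mem _ _
  obtain ⟨d, hd, H⟩ := descPochhammer_eval_add (p := p) k hNS
  obtain ⟨e, he, h1⟩ := H p hp
  obtain ⟨e', he', h1'⟩ := H (-(1 / 2) * p) (mul_mem (neg_mem h2) hp)
  have hhalf : (N : ℚ) + -(1 / 2) * p = 1 / 2 := by
    have : (p : ℚ) + 1 = 2 * N := by exact_mod_cast hN
    linear_combination (-1 / 2) * this
  rw [hhalf] at h1'
  set A := (descPochhammer ℚ k).eval (N : ℚ) with hA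
  -- The difference divided by p², before the factor 1/k!²: the terms -Adp and Adp have cancelled.
  have hres : (1 / 2 : ℚ) ^ 2 * d ^ 2 - d * (1 / 2) ^ 2 * p * e' + 2 * (1 / 2) ^ 2 * A * e' +
      e' ^ 2 * (1 / 2) ^ 2 * (1 / 2) ^ 2 * p ^ 2 + A * e ∈ integralRat p := by
    have h2' : (2 : ℚ) ∈ integralRat p := ofNat_mem _ 2
    refine add_mem (add_mem (add_mem (sub_mem ?_ ?_) ?_) ?_) (mul_mem hPN he)
    · exact mul_mem (pow_mem h2 2) (pow_mem hd 2)
    · exact mul_mem (mul_mem (mul_mem hd (pow_mem h2 2)) hp) he'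
    · exact mul_mem (mul_mem (mul_mem h2' (pow_mem h2 2)) hPN) he'
    · exact mul_mem (mul_mem (mul_mem (pow_mem he' 2) (pow_mem h2 2)) (pow_mem h2 2)) (pow_mem hp 2)
  refine ⟨_, mul_mem hres (pow_mem hf 2), ?_⟩
  rw [hc N, hc (N + p), halfChoose, Nat.cast_add, h1, h1', ← hA, div_eq_mul_inv]
  ring

theorem coeff_one_sub_X_sq_pow_mul_odd_congrSq {r : ℕ} (hr : 2 * r + 1 < p) :
    CongrSq p (((1 - X ^ 2) ^ (2 * r + 1) * (1 - X) ^ p : ℚ[X]).coeff (2 * r + 1))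
      (-(p * ((-16) ^ r / ((2 * r + 1) * (2 * r).choose r)))) := by
  set M := 2 * r + 1 with hM
  let g : ℕ → ℚ := fun i => (-1) ^ i * (M.choose i : ℚ) / ((M : ℕ) - 2 * i)
  have hsum : ∑ i ∈ range (M + 1), (if 2 * i ≤ M then g i else 0) =
      (-16) ^ r / ((2 * r + 1) * (2 * r).choose r) := by
    have htot : ∑ i ∈ range (M + 1), g i = 2 * (-16) ^ r / ((2 * r + 1) * (2 * r).choose r) :=
      sum_choose_div_sub_two_mul r
    -- For M odd, i ↦ M-i fixes g and swaps the two halves of the range, so the truncated sum is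
    -- half the full one.
    have hrefl : ∑ i ∈ range (M + 1), (if 2 * i ≤ M then g i else 0) =
        ∑ i ∈ range (M + 1), (if 2 * i ≤ M then 0 else g i) := by
      rw [← sum_range_reflect]
      refine sum_congr rfl fun i hi => ?_
      rw [mem_range] at hi
      rw [show M + 1 - 1 - i = M - i by omega]
      have hg : g (M - i) = g i := by
        simp only [g]
        rw [Nat.choose_symm (by omega), Nat.cast_sub (by omega),
          show (M : ℚ) - 2 * (M - i) = -(M - 2 * i) by ring, div_neg]
        have : (-1 : ℚ) ^ (M - i) = -(-1) ^ i := by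
          rcases Nat.even_or_odd i with h | h
          · rw [h.neg_one_pow, Odd.neg_one_pow]
            exact Nat.Odd.sub_even (by omega) ⟨r, hM⟩ h
          · rw [h.neg_one_pow, Even.neg_one_pow, neg_neg]
            exact Nat.Odd.sub_odd ⟨r, hM⟩ h
        rw [this]
        ring
      rw [hg]
      by_cases h : 2 * i ≤ M
      · rw [if_neg (by omega), if_pos h]
      · rw [if_pos (by omega), if_neg h]
    have hadd : ∑ i ∈ range (M + 1), (if 2 * i ≤ M then g i else 0) +
        ∑ i ∈ range (M + 1), (if 2 * i ≤ M then 0 else g i) = ∑ i ∈ range (M + 1), g i := by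
      rw [← sum_add_distrib]
      exact sum_congr rfl fun i _ => by split_ifs <;> simp
    rw [← hrefl, htot] at hadd
    linear_combination hadd / 2
  rw [← hsum, mul_sum, ← sum_neg_distrib, coeff_one_sub_X_sq_pow_mul]
  refine CongrSq.sum fun i _ => ?_
  split_ifs with h
  · have hMi : Odd (M - 2 * i) := ⟨r - i, by omega⟩
    rw [coeff_one_sub_X_pow, hMi.neg_one_pow]
    have h1 := choose_prime_congrSq (p := p) (j := M - 2 * i) (by omega) (by omega)
    rw [hMi.neg_one_pow, Nat.cast_sub h] at h1
    have hmem : -((-1 : ℚ) ^ i * (M.choose i : ℚ)) ∈ integralRat p :=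
      neg_mem (mul_mem (pow_mem (neg_mem (one_mem _)) i) (natCast_mem _ _))
    convert h1.mul_left hmem using 1
    · ring
    · simp only [g]
      push_cast
      ring
  · exact CongrSq.of_eq (by ring)

/-- For j > 0, C(p,2j) ≡ ½(-1)^j C(p,j) mod p², which matches the coefficient with Vandermonde's sum
for C(2m+p,m). The term j = 0 lacks the factor ½, hence the extra C(2m,m). -/
theorem coeff_one_sub_X_sq_pow_mul_even_congrSq (hodd : Odd p) {m : ℕ} (hm : 2 * m < p) :
    CongrSq p (((1 - X ^ 2) ^ (2 * m) * (1 - X) ^ p : ℚ[X]).coeff (2 * m))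
      (1 / 2 * (-1) ^ m * (((2 * m).choose m : ℚ) + (2 * m + p).choose m)) := by
  have hvan : ((2 * m + p).choose m : ℚ) =
      ∑ i ∈ range m, ((2 * m).choose i : ℚ) * p.choose (m - i) + (2 * m).choose m := by
    rw [Nat.add_choose_eq, Nat.sum_antidiagonal_eq_sum_range_succ_mk, sum_range_succ]
    push_cast
    simp
  have hcoeff : ((1 - X ^ 2) ^ (2 * m) * (1 - X) ^ p : ℚ[X]).coeff (2 * m) =
      ∑ i ∈ range m, (-1) ^ i * ((2 * m).choose i : ℚ) * p.choose (2 * (m - i)) +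
        (-1) ^ m * (2 * m).choose m := by
    rw [coeff_one_sub_X_sq_pow_mul, ← sum_range_add_sum_Ico _ (show m + 1 ≤ 2 * m + 1 by omega),
      sum_range_succ, sum_eq_zero (s := Ico (m + 1) (2 * m + 1)), add_zero]
    · congr 1
      · refine sum_congr rfl fun i hi => ?_
        rw [mem_range] at hi
        rw [if_pos (by omega), coeff_one_sub_X_pow, ← Nat.mul_sub, (even_two_mul (m - i)).neg_one_pow,
          one_mul]
      · rw [if_pos le_rfl, coeff_one_sub_X_pow]
        simp
    · intro i hi
      rw [mem_Ico] at hi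
      rw [if_neg (by omega), mul_zero]
  have hexp : (1 / 2 * (-1) ^ m * (((2 * m).choose m : ℚ) + (2 * m + p).choose m)) =
      ∑ i ∈ range m, 1 / 2 * (-1) ^ m * (((2 * m).choose i : ℚ) * p.choose (m - i)) +
        (-1) ^ m * (2 * m).choose m := by
    rw [hvan, ← mul_sum]
    ring
  rw [hcoeff, hexp]
  refine (CongrSq.sum fun i hi => ?_).add (CongrSq.refl _)
  rw [mem_range] at hi
  have h1 := choose_prime_congrSq (p := p) (j := 2 * (m - i)) (by omega) (by omega)
  have h2 := choose_prime_congrSq (p := p) (j := m - i) (by omega) (by omega)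
  rw [(even_two_mul (m - i)).neg_one_pow] at h1
  have hsgn : (-1 : ℚ) ^ m = (-1) ^ i * (-1) ^ (m - i) := by rw [← pow_add]; congr 1; omega
  have hsq : ((-1 : ℚ) ^ (m - i)) ^ 2 = 1 := by rw [← pow_mul, mul_comm, pow_mul]; simp
  have hu : (-1 : ℚ) ^ i * (2 * m).choose i ∈ integralRat p :=
    mul_mem (pow_mem (neg_mem (one_mem _)) i) (natCast_mem _ _)
  have hv : 1 / 2 * (-1) ^ m * ((2 * m).choose i : ℚ) ∈ integralRat p :=
    mul_mem (mul_mem (inv_two_mem hodd) (pow_mem (neg_mem (one_mem _)) m)) (natCast_mem _ _)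
  have h1' := h1.mul_left hu
  have h2' := (h2.mul_left hv).symm
  rw [mul_assoc _ _ ((p.choose (m - i) : ℕ) : ℚ)] at h2'
  refine h1'.trans ((CongrSq.of_eq ?_).trans h2')
  rw [hsgn]
  push_cast
  have hne : ((m - i : ℕ) : ℚ) ≠ 0 := by
    have : 0 < m - i := by omega
    positivity
  field_simp
  linear_combination (((2 * m).choose i : ℚ) * p) * hsq

/-- Modulo p, (1-X)^p is 1 in degrees below p; the outer p raises this to p². -/
theorem mul_coeff_one_sub_X_sq_pow_mul_congrSq {M l : ℕ} (hl : l ≤ M) (hlp : 2 * l < p) :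
    CongrSq p (p * ((1 - X ^ 2) ^ M * (1 - X) ^ p : ℚ[X]).coeff (2 * l))
      (p * ((-1) ^ l * M.choose l)) := by
  rw [coeff_one_sub_X_sq_pow_mul, ← coeff_one_sub_X_sq_pow_two_mul hl,
    ← mul_one ((1 - X ^ 2 : ℚ[X]) ^ M), coeff_one_sub_X_sq_pow_mul, mul_sum, mul_sum]
  refine CongrSq.sum fun i _ => ?_
  split_ifs with h
  · rw [coeff_one_sub_X_pow, coeff_one]
    split_ifs with h0
    · rw [h0]
      exact CongrSq.of_eq (by simp)
    · obtain ⟨w, hw⟩ := (Fact.out : p.Prime).dvd_choose_self h0 (by omega)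
      refine ⟨(-1) ^ i * M.choose i * (-1) ^ (2 * l - 2 * i) * w, ?_, ?_⟩
      · exact mul_mem (mul_mem (mul_mem (pow_mem (neg_mem (one_mem _)) _) (natCast_mem _ _))
          (pow_mem (neg_mem (one_mem _)) _)) (natCast_mem _ _)
      · rw [hw]
        push_cast
        ring
  · exact CongrSq.refl _

theorem choose_add_prime_congrSq {m : ℕ} (hm : p + 1 = 4 * m) :
    CongrSq p ((2 * m + p).choose m) ((2 * m).choose m * ((2 : ℚ) ^ (p - 1) - 2 * p)) := by
  have hp2 := (Fact.out : p.Prime).two_le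
  have hnat : ∀ j : ℕ, 0 < j → j < p → (1 : ℚ) / j ∈ integralRat p := fun j h0 hj => by
    rw [one_div]
    exact inv_natCast_mem (not_dvd_of_pos_of_lt h0 hj)
  have hprod : CongrSq p (∏ i ∈ range m, (1 + p * ((1 : ℚ) / ((2 * m : ℕ) - i))))
      (1 + p * ∑ i ∈ range m, (1 : ℚ) / ((2 * m : ℕ) - i)) := by
    refine prod_one_add_mul_congrSq _ fun i hi => ?_
    rw [mem_range] at hi
    rw [← Nat.cast_sub (by omega)]
    exact hnat _ (by omega) (by omega)
  have hsum : CongrSq p (p * ∑ i ∈ range m, (1 : ℚ) / ((2 * m : ℕ) - i))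
      (2 ^ (p - 1) - 1 - 2 * p) := by
    obtain ⟨n, hn⟩ : ∃ n, 2 * m = n + 1 := ⟨2 * m - 1, by omega⟩
    -- Here n = (p-1)/2: the first n alternating terms give ∑ C(p,j) over 0 < j ≤ n, which is
    -- 2^(p-1) - 1. The leftover term -1/(n+1) = -2/(p+1) gives -2p.
    rw [sum_inv_sub_eq_alternating, hn, sum_range_succ, mul_add]
    have hpn : p = 2 * n + 1 := by omega
    have hbin : (2 : ℚ) ^ (p - 1) - 1 = ∑ j ∈ range n, (p.choose (j + 1) : ℚ) := by
      have h := Nat.sum_range_choose_halfway n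
      rw [← hpn, sum_range_succ', Nat.choose_zero_right] at h
      have h' := congrArg (Nat.cast : ℕ → ℚ) h
      push_cast at h'
      rw [hpn, Nat.add_sub_cancel, pow_mul]
      rw [hpn] at h'
      norm_num at h' ⊢
      linear_combination -h'
    rw [hbin, sub_eq_add_neg]
    refine CongrSq.add ?_ ?_
    · rw [mul_sum]
      refine CongrSq.sum fun j hj => ?_
      rw [mem_range] at hj
      have := (choose_prime_congrSq (p := p) (j := j + 1) (by omega) (by omega)).symm
      convert this using 1
      push_cast
      rw [pow_succ]
      ring
    · have hne : ((n : ℚ) + 1) ≠ 0 := by positivity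
      have hodd : Odd n := ⟨m - 1, by omega⟩
      rw [hodd.neg_one_pow]
      refine ⟨1 / ((n + 1 : ℕ) : ℚ), hnat _ (by omega) (by omega), ?_⟩
      have : (p : ℚ) = 2 * n + 1 := by exact_mod_cast hpn
      push_cast
      field_simp
      rw [this]
      ring
  rw [choose_add_eq_mul_prod (2 * m) p (by omega : m ≤ 2 * m)]
  refine (hprod.trans ?_).mul_left (natCast_mem _ _)
  refine ((CongrSq.refl 1).add hsum).trans (CongrSq.of_eq ?_)
  ring

end Congruences

/-! ### Assembling the sums from coefficients. -/

section Assembly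

variable {p : ℕ} [Fact p.Prime]

theorem not_dvd_choose {n k : ℕ} (hn : n < p) (hk : k ≤ n) : ¬ p ∣ n.choose k := fun hd => by
  have := ((Fact.out : p.Prime).dvd_factorial).mp
    (hd.trans ⟨_, (Nat.choose_mul_factorial_mul_factorial hk).symm.trans (mul_assoc _ _ _)⟩)
  omega

theorem one_add_X_pow_mul_one_sub_X_pow (N q : ℕ) :
    ((1 + X) ^ N * (1 - X) ^ (N + q) : ℚ[X]) = (1 - X ^ 2) ^ N * (1 - X) ^ q := by
  rw [pow_add, ← mul_assoc, ← mul_pow]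
  ring

theorem sum_range_choose_mul_of_lt {N L : ℕ} (h : N < L) (g : ℕ → ℚ) :
    ∑ k ∈ range L, (N.choose k : ℚ) * g k = ∑ k ∈ range (N + 1), (N.choose k : ℚ) * g k := by
  refine (sum_subset (range_subset_range.mpr h) fun k _ hk => ?_).symm
  rw [mem_range, not_lt] at hk
  rw [Nat.choose_eq_zero_of_lt (by omega), Nat.cast_zero, zero_mul]

theorem sum_choose_mul_choose_add (N q : ℕ) :
    ∑ k ∈ range (N + 1), (N.choose k : ℚ) * ((-1) ^ k * (N + q).choose k) =
      ((1 - X ^ 2) ^ N * (1 - X) ^ q : ℚ[X]).coeff N := by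
  rw [← one_add_X_pow_mul_one_sub_X_pow, ← sum_choose_mul_choose]
  refine sum_congr rfl fun k hk => ?_
  rw [mem_range] at hk
  rw [Nat.choose_symm (by omega)]
  ring

theorem sum_halfChoose_sq_congrSq {N : ℕ} (hN : p + 1 = 2 * N) (hNp : N < p) :
    CongrSq p (∑ k ∈ range p, (-1) ^ k * halfChoose k ^ 2)
      (2 * ((1 - X ^ 2) ^ N : ℚ[X]).coeff N -
        ((1 - X ^ 2) ^ N * (1 - X) ^ p : ℚ[X]).coeff N) := by
  have h1 : CongrSq p (∑ k ∈ range p, (-1) ^ k * halfChoose k ^ 2)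
      (∑ k ∈ range p, (-1) ^ k * (2 * (N.choose k : ℚ) ^ 2 - N.choose k * (N + p).choose k)) :=
    CongrSq.sum fun k hk => (halfChoose_sq_congrSq hN (mem_range.mp hk)).mul_left
      (pow_mem (neg_mem (one_mem _)) k)
  refine h1.trans (CongrSq.of_eq ?_)
  have h2 := sum_choose_mul_choose_add N 0
  rw [pow_zero, mul_one] at h2
  rw [← h2, ← sum_choose_mul_choose_add N p, ← sum_range_choose_mul_of_lt hNp,
    ← sum_range_choose_mul_of_lt hNp, mul_sum, ← sum_sub_distrib]
  exact sum_congr rfl fun k _ => by rw [add_zero]; ring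

theorem sum_choose_sq_mul_sub_eq_zero {N : ℕ} (hN : Even N) :
    ∑ k ∈ range (N + 1), (N.choose k : ℚ) * ((-1) ^ k * N.choose k * (N - 2 * k)) = 0 := by
  have h := sum_range_reflect
    (fun k : ℕ => (N.choose k : ℚ) * ((-1) ^ k * N.choose k * (N - 2 * k))) (N + 1)
  have h' : ∑ j ∈ range (N + 1), ((N.choose (N + 1 - 1 - j) : ℚ) * ((-1) ^ (N + 1 - 1 - j) *
      N.choose (N + 1 - 1 - j) * (N - 2 * ((N + 1 - 1 - j : ℕ) : ℚ)))) =
      -∑ k ∈ range (N + 1), (N.choose k : ℚ) * ((-1) ^ k * N.choose k * (N - 2 * k)) := by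
    rw [← sum_neg_distrib]
    refine sum_congr rfl fun k hk => ?_
    rw [mem_range] at hk
    have hs : (-1 : ℚ) ^ (N - k) = (-1) ^ k := by
      have h1 : (-1 : ℚ) ^ (N - k) * (-1) ^ k = 1 := by
        rw [← pow_add, Nat.sub_add_cancel (by omega), hN.neg_one_pow]
      have h2 : ((-1 : ℚ) ^ k) ^ 2 = 1 := by rw [← pow_mul, mul_comm, pow_mul]; simp
      linear_combination (-1 : ℚ) ^ k * h1 - (-1 : ℚ) ^ (N - k) * h2
    rw [Nat.add_sub_cancel, Nat.choose_symm (by omega), Nat.cast_sub (by omega), hs]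
    ring
  rw [h'] at h
  linarith

/-- Split the weight as (n+1-k) - k and absorb each part into one binomial; both resulting sums are
coefficients of products of powers of 1+X and 1-X. -/
theorem sum_choose_mul_choose_mul_sub (n q : ℕ) :
    ∑ k ∈ range (n + 1 + 1), ((n + 1).choose k : ℚ) *
        ((-1) ^ k * (n + 1 + q).choose k * ((n + 1 : ℕ) - 2 * k)) =
      (2 * (n + 1 : ℚ) + q) * ((1 - X ^ 2) ^ n * (1 - X) ^ q : ℚ[X]).coeff n +
        q * (X * ((1 - X ^ 2) ^ n * (1 - X) ^ q) : ℚ[X]).coeff n := by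
  have hpoly : (C ((n : ℚ) + 1) * ((1 + X) ^ n * (1 - X) ^ (n + 1 + q)) +
      C ((n : ℚ) + 1 + q) * ((1 + X) ^ (n + 1) * (1 - X) ^ (n + q)) : ℚ[X]) =
      C (2 * ((n : ℚ) + 1) + q) * ((1 - X ^ 2) ^ n * (1 - X) ^ q) +
      C (q : ℚ) * (X * ((1 - X ^ 2) ^ n * (1 - X) ^ q)) := by
    rw [show n + 1 + q = (n + q) + 1 by ring, pow_succ (1 - X : ℚ[X]) (n + q),
      pow_succ (1 + X : ℚ[X]) n, ← one_add_X_pow_mul_one_sub_X_pow]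
    simp only [map_add, map_mul, map_one, map_ofNat]
    ring
  have hc := congrArg (fun f : ℚ[X] => f.coeff n) hpoly
  simp only [coeff_add, coeff_C_mul] at hc
  rw [← hc, ← sum_choose_mul_choose, ← sum_choose_mul_choose, mul_sum, mul_sum]
  have hterm : ∀ k : ℕ, k ≤ n + 1 → ((n + 1).choose k : ℚ) *
      ((-1) ^ k * (n + 1 + q).choose k * ((n + 1 : ℕ) - 2 * k)) =
      ((n : ℚ) + 1) * ((-1) ^ k * n.choose k * (n + 1 + q).choose k) -
        (-1) ^ k * (n + 1).choose k * ((n + 1 + q).choose k * k) := by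
    intro k hk
    have h := congrArg (Nat.cast : ℕ → ℚ) (Nat.choose_mul_succ_eq n k)
    rw [Nat.cast_mul, Nat.cast_mul, Nat.cast_sub hk] at h
    push_cast at h ⊢
    linear_combination (-(-1 : ℚ) ^ k * (n + 1 + q).choose k) * h
  rw [sum_congr rfl fun k hk => hterm k (by rw [mem_range] at hk; omega), sum_sub_distrib]
  have hA : ∑ k ∈ range (n + 1 + 1), ((n : ℚ) + 1) * ((-1) ^ k * n.choose k * (n + 1 + q).choose k)
      = ∑ k ∈ range (n + 1), ((n : ℚ) + 1) * ((-1) ^ k * n.choose (n - k) * (n + 1 + q).choose k) := by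
    rw [sum_range_succ, Nat.choose_succ_self]
    simp only [Nat.cast_zero, mul_zero, zero_mul, add_zero]
    refine sum_congr rfl fun k hk => ?_
    rw [mem_range] at hk
    rw [Nat.choose_symm (by omega)]
  have hB : ∑ k ∈ range (n + 1 + 1), (-1) ^ k * ((n + 1).choose k : ℚ) * ((n + 1 + q).choose k * k)
      = -∑ k ∈ range (n + 1), ((n : ℚ) + 1 + q) *
        ((-1) ^ k * (n + 1).choose (n - k) * (n + q).choose k) := by
    rw [sum_range_succ', ← sum_neg_distrib]
    simp only [Nat.cast_zero, mul_zero, add_zero]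
    refine sum_congr rfl fun k hk => ?_
    rw [mem_range] at hk
    have h := congrArg (Nat.cast : ℕ → ℚ) (Nat.add_one_mul_choose_eq (n + q) k)
    push_cast at h ⊢
    rw [← Nat.choose_symm (show n - k ≤ n + 1 by omega), show n + 1 - (n - k) = k + 1 by omega,
      show n + 1 + q = n + q + 1 by ring, pow_succ]
    linear_combination ((-1 : ℚ) ^ k * (n + 1).choose (k + 1)) * h
  rw [hA, hB, sub_neg_eq_add]

/-- Since 2N = p+1, 1-4k = 2(N-2k) - p. The N-2k part of the C(N,k)² sum vanishes by reflection, and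
the terms carrying p are needed only modulo p, where they cancel. -/
theorem sum_halfChoose_sq_mul_congrSq {r : ℕ} (hr : p = 4 * r + 3) :
    CongrSq p (∑ k ∈ range p, (-1) ^ k * halfChoose k ^ 2 * (1 - 4 * k))
      (-2 * ((1 - X ^ 2) ^ (2 * r + 1) * (1 - X) ^ p : ℚ[X]).coeff (2 * r + 1)) := by
  set N := 2 * r + 2 with hN
  have hpN : p + 1 = 2 * N := by omega
  have h1 : CongrSq p (∑ k ∈ range p, (-1) ^ k * halfChoose k ^ 2 * (1 - 4 * k))
      (∑ k ∈ range p, (-1) ^ k * (1 - 4 * (k : ℚ)) *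
        (2 * (N.choose k : ℚ) ^ 2 - N.choose k * (N + p).choose k)) := by
    refine CongrSq.sum fun k hk => ?_
    have hmem : (-1 : ℚ) ^ k * (1 - 4 * (k : ℚ)) ∈ integralRat p :=
      mul_mem (pow_mem (neg_mem (one_mem _)) k)
        (sub_mem (one_mem _) (mul_mem (ofNat_mem _ 4) (natCast_mem _ k)))
    refine (CongrSq.of_eq ?_).trans ((halfChoose_sq_congrSq hpN (mem_range.mp hk)).mul_left hmem)
    ring
  set W := ((1 - X ^ 2) ^ (2 * r + 1) * (1 - X) ^ p : ℚ[X]).coeff (2 * r + 1) with hW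
  set U := ((1 - X ^ 2) ^ N * (1 - X) ^ p : ℚ[X]).coeff N with hU
  set V := (X * ((1 - X ^ 2) ^ (2 * r + 1) * (1 - X) ^ p) : ℚ[X]).coeff (2 * r + 1) with hV
  have hV' : V = ((1 - X ^ 2) ^ (2 * r + 1) * (1 - X) ^ p : ℚ[X]).coeff (2 * r) := by
    rw [hV, coeff_X_mul]
  have hF : ((1 - X ^ 2) ^ N : ℚ[X]).coeff N = (-1) ^ (r + 1) * N.choose (r + 1) :=
    coeff_one_sub_X_sq_pow_two_mul (by omega : r + 1 ≤ N)
  have hsum : ∑ k ∈ range p, (-1) ^ k * (1 - 4 * (k : ℚ)) *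
        (2 * (N.choose k : ℚ) ^ 2 - N.choose k * (N + p).choose k) =
      -2 * W - 4 * (p * W) + (p * U - 2 * (p * V)) - 2 * (p * ((-1) ^ (r + 1) * N.choose (r + 1))) := by
    have hz := sum_choose_sq_mul_sub_eq_zero (N := N) ⟨r + 1, by omega⟩
    have hv := sum_choose_mul_choose_mul_sub (2 * r + 1) p
    rw [← hW, ← hV] at hv
    have h2 := sum_choose_mul_choose_add N 0
    rw [pow_zero, mul_one, hF] at h2
    have h3 := sum_choose_mul_choose_add N p
    rw [← hU] at h3
    rw [← sum_range_choose_mul_of_lt (L := p) (by omega)] at hz hv h2 h3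
    have hp' : (p : ℚ) + 1 = 2 * N := by exact_mod_cast hpN
    have hr' : (2 * (((2 * r + 1 : ℕ) : ℚ) + 1) + p) = 1 + 2 * p := by
      rw [hr]; push_cast; ring
    rw [hr'] at hv
    have : ∀ k : ℕ, (-1) ^ k * (1 - 4 * (k : ℚ)) *
        (2 * (N.choose k : ℚ) ^ 2 - N.choose k * (N + p).choose k) =
        4 * ((N.choose k : ℚ) * ((-1) ^ k * N.choose k * (N - 2 * k))) -
        2 * ((N.choose k : ℚ) * ((-1) ^ k * (N + p).choose k * (N - 2 * k))) -
        2 * p * ((N.choose k : ℚ) * ((-1) ^ k * (N + 0).choose k)) +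
        p * ((N.choose k : ℚ) * ((-1) ^ k * (N + p).choose k)) := by
      intro k
      rw [add_zero]
      linear_combination ((-1) ^ k * (2 * (N.choose k : ℚ) ^ 2 -
        (N.choose k : ℚ) * (N + p).choose k)) * hp'
    simp_rw [this]
    rw [sum_add_distrib, sum_sub_distrib, sum_sub_distrib, ← mul_sum, ← mul_sum, ← mul_sum,
      ← mul_sum, hz, h2, h3]
    have hv' : ∑ k ∈ range p, (N.choose k : ℚ) * ((-1) ^ k * (N + p).choose k * (N - 2 * k)) =
      (1 + 2 * p) * W + p * V := hv
    rw [hv']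
    ring
  rw [hsum] at h1
  refine h1.trans ?_
  -- W is itself p times an integral rational, so pW vanishes mod p².
  have hpW : CongrSq p (4 * (p * W)) 0 := by
    obtain ⟨s, hs, h⟩ := coeff_one_sub_X_sq_pow_mul_odd_congrSq (p := p) (r := r) (by omega)
    rw [← hW] at h
    have hden : (((2 * r + 1 : ℕ) : ℚ))⁻¹ * ((2 * r).choose r : ℚ)⁻¹ ∈ integralRat p :=
      mul_mem (inv_natCast_mem (not_dvd_of_pos_of_lt (by omega) (by omega)))
        (inv_natCast_mem (not_dvd_choose (by omega) (by omega)))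
    have h16 : (-16 : ℚ) ^ r ∈ integralRat p := pow_mem (neg_mem (ofNat_mem _ 16)) r
    refine ⟨4 * (-((-16) ^ r * ((((2 * r + 1 : ℕ) : ℚ))⁻¹ * ((2 * r).choose r : ℚ)⁻¹)) + p * s),
      mul_mem (ofNat_mem _ 4) (add_mem (neg_mem (mul_mem h16 hden))
        (mul_mem (natCast_mem _ p) hs)), ?_⟩
    have hW2 : W = p ^ 2 * s - p * ((-16) ^ r / ((2 * r + 1) * (2 * r).choose r)) := by
      linear_combination h
    rw [hW2]
    push_cast
    rw [div_eq_mul_inv, mul_inv]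
    ring
  have hpU := mul_coeff_one_sub_X_sq_pow_mul_congrSq (p := p) (M := N) (l := r + 1) (by omega)
    (by omega)
  have hpV := mul_coeff_one_sub_X_sq_pow_mul_congrSq (p := p) (M := 2 * r + 1) (l := r) (by omega)
    (by omega)
  rw [← hV'] at hpV
  have hpU' : CongrSq p (p * U) (p * ((-1) ^ (r + 1) * N.choose (r + 1))) := hpU
  have hB : (N.choose (r + 1) : ℚ) = 2 * (2 * r + 1).choose r := by
    rw [hN, Nat.choose_succ_succ, ← Nat.choose_symm_half r]
    push_cast
    ring
  have := (((CongrSq.refl (p := p) (-2 * W)).sub hpW).add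
    (hpU'.sub (hpV.mul_left (ofNat_mem _ 2)))).sub
    (CongrSq.refl (2 * (p * ((-1) ^ (r + 1) * (N.choose (r + 1) : ℚ)))))
  refine this.trans (CongrSq.of_eq ?_)
  rw [hB, pow_succ]
  ring

/-- Fermat's little theorem for the base `2`. -/
theorem exists_two_pow_sub_one_eq (hodd : Odd p) : ∃ f : ℤ, (2 : ℚ) ^ (p - 1) = 1 + p * f := by
  have h2 : ¬ p ∣ 2 := fun h => by
    have := (Fact.out : p.Prime).two_le
    have := Nat.le_of_dvd (by norm_num) h
    obtain ⟨k, hk⟩ := hodd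
    omega
  have h : (p : ℤ) ∣ 2 ^ (p - 1) - 1 := by
    rw [← ZMod.intCast_zmod_eq_zero_iff_dvd]
    push_cast
    rw [ZMod.pow_card_sub_one_eq_one, sub_self]
    intro h
    exact h2 ((ZMod.natCast_eq_zero_iff 2 p).mp (by exact_mod_cast h))
  obtain ⟨f, hf⟩ := h
  refine ⟨f, ?_⟩
  have : (2 : ℤ) ^ (p - 1) = 1 + p * f := by linear_combination hf
  exact_mod_cast this

theorem sum_congrSq_of_eq_sq_add_four_mul_sq {r : ℕ} (hr : p = 4 * r + 1) {x y : ℤ}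
    (hxy : (p : ℤ) = x ^ 2 + 4 * y ^ 2) (hx : x ≡ 1 [ZMOD 4]) :
    (-1 : ℚ) ^ r * ((p : ℚ) / x) ∈ integralRat p ∧
    CongrSq p (∑ k ∈ range p, (-1) ^ k * halfChoose k ^ 2) ((-1) ^ r * ((p : ℚ) / x)) := by
  have hp2 := (Fact.out : p.Prime).two_le
  have hodd : Odd p := ⟨2 * r, by omega⟩
  obtain ⟨f, hf⟩ := exists_two_pow_sub_one_eq hodd
  obtain ⟨e, he⟩ := choose_two_mul_congr_of_eq_sq_add_four_mul_sq hr hxy hx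
  set c := (2 * r).choose r with hc
  have hcp : ¬ p ∣ c := not_dvd_choose (by omega) (by omega)
  have hxp : ¬ (p : ℤ) ∣ x := by
    intro h
    apply hcp
    rw [← Int.natCast_dvd_natCast, show (c : ℤ) = p * e + 2 * x by linear_combination he]
    exact (dvd_mul_right _ _).add (h.mul_left 2)
  have hx0 : (x : ℚ) ≠ 0 := by
    intro h
    exact hxp (by rw [Int.cast_eq_zero.mp h]; exact dvd_zero _)
  have hc0 : (c : ℚ) ≠ 0 := by
    intro h
    exact hcp (by rw [Nat.cast_eq_zero.mp h]; exact dvd_zero _)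
  have hxS := inv_intCast_mem hxp
  have hsgn : (-1 : ℚ) ^ r ∈ integralRat p := pow_mem (neg_mem (one_mem _)) r
  refine ⟨mul_mem hsgn (by rw [div_eq_mul_inv]; exact mul_mem (natCast_mem _ p) hxS), ?_⟩
  refine (sum_halfChoose_sq_congrSq (N := 2 * r + 1) (by omega) (by omega)).trans ?_
  rw [coeff_one_sub_X_sq_pow_of_odd ⟨r, rfl⟩]
  refine (((CongrSq.refl _).sub (coeff_one_sub_X_sq_pow_mul_odd_congrSq (p := p) (r := r)
    (by omega)))).trans ?_
  have he' : (c : ℚ) = 2 * x + p * e := by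
    have : (c : ℤ) = 2 * x + p * e := by linear_combination he
    exact_mod_cast this
  -- Behind the factor p only residues mod p count: 16^r = 2^(p-1) ≡ 1, 2r+1 ≡ 1/2 and c ≡ 2x.
  have h16 : (-16 : ℚ) ^ r = (-1) ^ r * (1 + p * f) := by
    rw [← hf, show p - 1 = 4 * r by omega, pow_mul, ← mul_pow]
    norm_num
  have hp' : (p : ℚ) = 4 * r + 1 := by exact_mod_cast hr
  have hr0 : (((2 * r + 1 : ℕ) : ℚ)) ≠ 0 := by positivity
  refine ⟨(-1) ^ r * (2 * f * x - e - c) * (1 / 2) * ((((2 * r + 1 : ℕ) : ℚ))⁻¹ * (c : ℚ)⁻¹ *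
    (x : ℚ)⁻¹), ?_, ?_⟩
  · refine mul_mem (mul_mem (mul_mem hsgn ?_) (inv_two_mem hodd)) (mul_mem (mul_mem ?_ ?_) hxS)
    · exact sub_mem (sub_mem (mul_mem (mul_mem (ofNat_mem _ 2) (intCast_mem _ _))
        (intCast_mem _ _)) (intCast_mem _ _)) (natCast_mem _ _)
    · exact inv_natCast_mem (not_dvd_of_pos_of_lt (by omega) (by omega))
    · exact inv_natCast_mem hcp
  · rw [h16, ← hc]
    rw [show (2 * (r : ℚ) + 1) = ((2 * r + 1 : ℕ) : ℚ) by push_cast; ring]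
    have hR : (((2 * r + 1 : ℕ) : ℚ)) = (p + 1) / 2 := by rw [hp']; push_cast; ring
    rw [hR] at hr0 ⊢
    have hp1 : (p : ℚ) + 1 ≠ 0 := by positivity
    field_simp
    linear_combination (-(p : ℚ) * (-1) ^ r) * he'

theorem sum_congrSq_of_three_mod_four {r : ℕ} (hr : p = 4 * r + 3) :
    CongrSq p (∑ k ∈ range p, (-1) ^ k * halfChoose k ^ 2)
      ((-1) ^ (r + 1) * (2 * p + 3 - 2 ^ (p - 1)) * (2 * r + 1).choose r) := by
  have hodd : Odd p := ⟨2 * r + 1, by omega⟩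
  have h2 := inv_two_mem hodd
  have h1 := sum_halfChoose_sq_congrSq (p := p) (N := 2 * (r + 1)) (by omega) (by omega)
  rw [coeff_one_sub_X_sq_pow_two_mul (by omega)] at h1
  have h3 := coeff_one_sub_X_sq_pow_mul_even_congrSq hodd (m := r + 1) (by omega)
  have h4 := choose_add_prime_congrSq (p := p) (m := r + 1) (by omega)
  have hmem : (1 / 2 * (-1) ^ (r + 1) : ℚ) ∈ integralRat p :=
    mul_mem h2 (pow_mem (neg_mem (one_mem _)) _)
  have h5 := h3.trans (((CongrSq.refl _).add h4).mul_left hmem)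
  refine h1.trans (((CongrSq.refl _).sub h5).trans (CongrSq.of_eq ?_))
  have hB : ((2 * (r + 1)).choose (r + 1) : ℚ) = 2 * (2 * r + 1).choose r := by
    rw [show 2 * (r + 1) = 2 * r + 1 + 1 by ring, Nat.choose_succ_succ, ← Nat.choose_symm_half r]
    push_cast
    ring
  rw [hB]
  ring

theorem coeff_one_sub_X_sq_pow_mul_congrSq_of_three_mod_four {r : ℕ} (hr : p = 4 * r + 3) :
    CongrSq p (((1 - X ^ 2) ^ (2 * r + 1) * (1 - X) ^ p : ℚ[X]).coeff (2 * r + 1))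
      (-((-1) ^ r * (p / (2 * r + 1).choose r))) := by
  have hodd : Odd p := ⟨2 * r + 1, by omega⟩
  have h2 := inv_two_mem hodd
  obtain ⟨f, hf⟩ := exists_two_pow_sub_one_eq hodd
  refine (coeff_one_sub_X_sq_pow_mul_odd_congrSq (p := p) (r := r) (by omega)).trans ?_
  set B := (2 * r + 1).choose r with hB
  have hBp : ¬ p ∣ B := not_dvd_choose (by omega) (by omega)
  have hB0 : (B : ℚ) ≠ 0 := by
    intro h
    exact hBp (by rw [Nat.cast_eq_zero.mp h]; exact dvd_zero _)
  have hC : (2 * (r : ℚ) + 1) * (2 * r).choose r = B * (r + 1) := by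
    have := Nat.add_one_mul_choose_eq (2 * r) r
    rw [Nat.choose_symm_half] at this
    exact_mod_cast this
  have h16 : (-16 : ℚ) ^ r = (-1) ^ r * ((1 + p * f) / 4) := by
    rw [← hf, show p - 1 = 4 * r + 2 by omega, pow_add, pow_mul]
    norm_num
    rw [← mul_pow]
    norm_num
  have hp' : (r : ℚ) + 1 = (p + 1) / 4 := by rw [hr]; push_cast; ring
  have hr1 : ((r + 1 : ℕ) : ℚ) = (p + 1) / 4 := by push_cast; exact hp'
  refine ⟨-((-1) ^ r * (f - 1) * ((1 / 2) ^ 2 * ((((r + 1 : ℕ) : ℚ))⁻¹ * (B : ℚ)⁻¹))), ?_, ?_⟩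
  · refine neg_mem (mul_mem (mul_mem (pow_mem (neg_mem (one_mem _)) _)
      (sub_mem (intCast_mem _ _) (one_mem _))) (mul_mem (pow_mem h2 2) (mul_mem ?_ ?_)))
    · exact inv_natCast_mem (not_dvd_of_pos_of_lt (by omega) (by omega))
    · exact inv_natCast_mem hBp
  · rw [hC, h16, hp', hr1]
    have hp1 : (p : ℚ) + 1 ≠ 0 := by positivity
    field_simp
    ring

end Assembly
end RatCongr

/-! ### The main theorem. -/

theorem theorem3p2 (p : ℕ) (hp : p.Prime) (hodd : Odd p) :
    (∀ x y : ℤ, (p : ℤ) = x ^ 2 + 4 * y ^ 2 → x ≡ 1 [ZMOD 4] →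
      RatModEq p 2
        (∑ k ∈ Finset.range p,
          ((2 * k).choose k : ℚ) ^ 2 / ((-16 : ℚ) ^ k * (2 * (k : ℚ) - 1) ^ 2))
        ((-1 : ℚ) ^ ((p - 1) / 4) * ((p : ℚ) / (x : ℚ)))) ∧
    (p ≡ 3 [MOD 4] →
      RatModEq p 2
        (∑ k ∈ Finset.range p,
          ((2 * k).choose k : ℚ) ^ 2 / ((-16 : ℚ) ^ k * (2 * (k : ℚ) - 1) ^ 2))
        ((-1 : ℚ) ^ ((p + 1) / 4) * (2 * (p : ℚ) + 3 - 2 ^ (p - 1)) *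
          (((p - 1) / 2).choose ((p - 3) / 4) : ℚ)) ∧
      RatModEq p 2
        (∑ k ∈ Finset.range p,
          ((2 * k).choose k : ℚ) ^ 2 / ((-16 : ℚ) ^ k * (2 * (k : ℚ) - 1)))
        (1 / 2 * (-1 : ℚ) ^ ((p - 3) / 4) * (2 * (p : ℚ) + 3 - 2 ^ (p - 1)) *
            (((p - 1) / 2).choose ((p - 3) / 4) : ℚ) -
          (-1 : ℚ) ^ ((p - 3) / 4) *
            ((p : ℚ) / (((p - 1) / 2).choose ((p - 3) / 4) : ℚ)))) := by
  have : Fact p.Prime := ⟨hp⟩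
  simp_rw [RatCongr.choose_sq_div_eq_halfChoose_sq, RatCongr.choose_sq_div_eq_halfChoose_sq_mul]
  refine ⟨fun x y hxy hx => ?_, fun h3 => ?_⟩
  · obtain ⟨r, hr⟩ : ∃ r, p = 4 * r + 1 := by
      obtain ⟨a, ha⟩ : ∃ a, x = 4 * a + 1 := ⟨x / 4, by have : x % 4 = 1 := hx; omega⟩
      have : (p : ℤ) = 4 * (4 * a ^ 2 + 2 * a + y ^ 2) + 1 := by rw [hxy, ha]; ring
      exact ⟨p / 4, by omega⟩
    rw [show (p - 1) / 4 = r by omega]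
    obtain ⟨hmem, h⟩ := RatCongr.sum_congrSq_of_eq_sq_add_four_mul_sq hr hxy hx
    exact h.ratModEq hmem
  · obtain ⟨r, hr⟩ : ∃ r, p = 4 * r + 3 := ⟨p / 4, by have : p % 4 = 3 := h3; omega⟩
    rw [show (p + 1) / 4 = r + 1 by omega, show (p - 1) / 2 = 2 * r + 1 by omega,
      show (p - 3) / 4 = r by omega]
    have hS2 := RatCongr.sum_congrSq_of_three_mod_four hr
    have hG := (RatCongr.sum_halfChoose_sq_mul_congrSq hr).trans
      ((RatCongr.coeff_one_sub_X_sq_pow_mul_congrSq_of_three_mod_four hr).mul_left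
        (neg_mem (ofNat_mem _ 2)))
    have h2 := RatCongr.inv_two_mem hodd
    have hsgn : ∀ k : ℕ, (-1 : ℚ) ^ k ∈ RatCongr.integralRat p := fun k =>
      pow_mem (neg_mem (one_mem _)) k
    have hp' : (p : ℚ) ∈ RatCongr.integralRat p := natCast_mem _ p
    have hq : 2 * (p : ℚ) + 3 - 2 ^ (p - 1) ∈ RatCongr.integralRat p :=
      sub_mem (add_mem (mul_mem (ofNat_mem _ 2) hp') (ofNat_mem _ 3)) (pow_mem (ofNat_mem _ 2) _)
    have hB : (((2 * r + 1).choose r : ℕ) : ℚ)⁻¹ ∈ RatCongr.integralRat p :=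
      RatCongr.inv_natCast_mem (RatCongr.not_dvd_choose (by omega) (by omega))
    refine ⟨hS2.ratModEq (mul_mem (mul_mem (hsgn _) hq) (natCast_mem _ _)), ?_⟩
    -- The third sum is minus half of this combination, as 2k-1 = -(1 + (1-4k))/2.
    have h := ((hS2.add hG).mul_left h2)
    have h' := (RatCongr.CongrSq.refl (p := p) 0).sub h
    refine RatCongr.CongrSq.ratModEq (sub_mem ?_ ?_)
      (((RatCongr.CongrSq.of_eq ?_).trans h').trans (RatCongr.CongrSq.of_eq ?_))
    · exact mul_mem (mul_mem (mul_mem h2 (hsgn _)) hq) (natCast_mem _ _)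
    · rw [div_eq_mul_inv]
      exact mul_mem (hsgn _) (mul_mem hp' hB)
    · rw [← Finset.sum_add_distrib, Finset.mul_sum, zero_sub, ← Finset.sum_neg_distrib]
      exact Finset.sum_congr rfl fun k _ => by ring
    · rw [pow_succ]
      ring
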